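/- Let $(X,\mathcal B,\mu)$ be a $\sigma$-finite measure space and let $H$ be a reproducing kernel Hilbert space over $X$ (a Hilbert space of functions $X\to\mathbb C$ with continuous point evaluations) which is also a closed subspace of $L^2(X,\mu)$, i.e. every $f\in H$ is square integrable and $\|f\|_H=\|f\|_{L^2(\mu)}$. Assume that for every $x\in X$ some $f\in H$ has $f(x)\neq 0$ (for instance, that $1\in H$). Let $\mathcal A$ be a dual algebra of multipliers on $H$: a unital, weak-$*$ closed subalgebra of $B(H)$ all of whose elements are multiplication operators $M_\phi f=\phi f$ by functions $\phi$ on $X$; we write $\phi\in\mathcal A$ for $M_\phi\in\mathcal A$. For $f\in H$ and $\nu=|f|^2\mu$ let $\mathcal A^2(\nu)$ be the closure of $\mathcal A$ in $L^2(X,\nu)$. For $x\in X$ let $k^\nu_x\in\mathcal A^2(\nu)$ be the vector with $\langle\phi,k^\nu_x\rangle_{L^2(\nu)}=\phi(x)$ for all $\phi\in\mathcal A$ if evaluation at $x$ is bounded on $\mathcal A$ in the norm of $L^2(\nu)$, and $k^\nu_x=0$ otherwise. Put $k^\nu(x,y)=\langle k^\nu_y,k^\nu_x\rangle_{L^2(\nu)}$.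 Then for all $x_1,\dots,x_n\in X$ and $w_1,\dots,w_n\in\mathbb C$ the following are equivalent: (i) there is $\phi\in\mathcal A$ with $\sup_{x\in X}|\phi(x)|\le 1$ and $\phi(x_i)=w_i$ for $i=1,\dots,n$; (ii) the matrix $$\left[(1-w_i\overline{w_j})\,k^\nu(x_i,x_j)\right]_{i,j=1}^n$$ is positive semidefinite for every measure of the form $\nu=|f|^2\mu$ with $f\in H$. -/

import Mathlib

open MeasureTheory
open scoped Topology ENNReal ComplexConjugate ComplexOrder

noncomputable section

namespace PickDual

section Operators

variable {H : Type*} [NormedAddCommGroup H] [InnerProductSpace ℂ H]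

/-- Pairs `(u, v)` of square-summable sequences in `H`. Such a pair represents the trace class
operator `∑ₙ uₙ ⊗ vₙ`, and every trace class operator on a Hilbert space is of this form. -/
abbrev SqSummablePair (H : Type*) [NormedAddCommGroup H] : Type _ :=
  {p : (ℕ → H) × (ℕ → H) // Summable (fun n => ‖p.1 n‖ ^ 2) ∧ Summable (fun n => ‖p.2 n‖ ^ 2)}

/-- The weak-* (ultraweak) topology of `B(H)`, as the dual of the trace class operators: the
coarsest topology for which all functionals `T ↦ ∑ₙ ⟨T uₙ, vₙ⟩` are continuous
(Mathlib's inner product is linear in its second variable). -/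
abbrev weakStarTopology (H : Type*) [NormedAddCommGroup H] [InnerProductSpace ℂ H] :
    TopologicalSpace (H →L[ℂ] H) :=
  TopologicalSpace.induced
    (fun (T : H →L[ℂ] H) (p : SqSummablePair H) => ∑' n, inner ℂ (p.1.2 n) (T (p.1.1 n)))
    inferInstance

/-- A dual algebra: a unital subalgebra of `B(H)` that is closed in the weak-* topology. -/
def IsDualAlgebra (A : Subalgebra ℂ (H →L[ℂ] H)) : Prop :=
  IsClosed[weakStarTopology H] (A : Set (H →L[ℂ] H))

end Operators

section Multipliers

variable {X H : Type*} [NormedAddCommGroup H] [InnerProductSpace ℂ H] [RKHS ℂ H X ℂ]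

/-- `T` is the operator `M_φ` of multiplication by the function `φ` on `X`. -/
def IsMulOp (T : H →L[ℂ] H) (φ : X → ℂ) : Prop :=
  ∀ (f : H) (x : X), T f x = φ x * f x

/-- The multiplier algebra `M(H)`: all multiplication operators on `H`. -/
def multiplierAlgebra (H : Type*) {X : Type*} [NormedAddCommGroup H] [InnerProductSpace ℂ H]
    [RKHS ℂ H X ℂ] : Set (H →L[ℂ] H) :=
  {T | ∃ φ : X → ℂ, IsMulOp T φ}

/-- A dual algebra of multipliers: a dual algebra contained in `M(H)`. -/
structure IsDualAlgebraOfMultipliers (A : Subalgebra ℂ (H →L[ℂ] H)) : Prop where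
  isDualAlgebra : IsDualAlgebra A
  subset_multipliers : (A : Set (H →L[ℂ] H)) ⊆ multiplierAlgebra H

/-- The functions `φ` on `X` with `M_φ ∈ A`, that is, `A` regarded as a set of functions. -/
def symbols (A : Subalgebra ℂ (H →L[ℂ] H)) : Set (X → ℂ) :=
  {φ | ∃ T ∈ A, IsMulOp T φ}

end Multipliers

section Kernels

variable {X : Type*} [MeasurableSpace X]

/-- For a set `S` of functions on `X`, the closure in `L²(X, ν)` of the subspace spanned by those
members of `S` that are square integrable. For `S` the functions of an algebra of multipliers
and `ν = |f|²μ` this is the space `A²(ν)`. -/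
def closureL2 (S : Set (X → ℂ)) (ν : Measure X) : Submodule ℂ (Lp ℂ 2 ν) :=
  (Submodule.span ℂ {g | ∃ φ ∈ S, ∃ h : MemLp φ 2 ν, h.toLp φ = g}).topologicalClosure

/-- `k` is the reproducing kernel of the space `closureL2 S ν` at `x`:
it lies in that space and `φ x = ⟨φ, k⟩` for every `φ` in `S`. -/
def IsReproducingAt (S : Set (X → ℂ)) (ν : Measure X) (x : X) (k : Lp ℂ 2 ν) : Prop :=
  k ∈ closureL2 S ν ∧ ∀ φ ∈ S, ∀ h : MemLp φ 2 ν, inner ℂ k (h.toLp φ) = φ x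

open Classical in
/-- The reproducing kernel `k_x^ν` at `x`. It is set to `0` at the points `x` at which evaluation
is not bounded in the norm of `L²(ν)`, where no reproducing kernel exists. -/
def kernelVec (S : Set (X → ℂ)) (ν : Measure X) (x : X) : Lp ℂ 2 ν :=
  if h : ∃ k, IsReproducingAt S ν x k then h.choose else 0

/-- The kernel function `k^ν(x, y) = ⟨k_y^ν, k_x^ν⟩` (linear in `k_y^ν`). -/
def kernelFn (S : Set (X → ℂ)) (ν : Measure X) (x y : X) : ℂ :=
  inner ℂ (kernelVec S ν x) (kernelVec S ν y)

/-- The measure `|f|²μ`. -/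
def absSqMeasure (f : X → ℂ) (μ : Measure X) : Measure X :=
  μ.withDensity (fun x => ‖f x‖ₑ ^ 2)

/-- The reproducing kernel Hilbert space `H` of functions on `X` is a closed subspace of
`L²(X, μ)`: its members are square integrable and its norm is the norm of `L²(X, μ)`
(the image in `L²(X, μ)` is closed when `H` is complete). -/
def IsSubspaceL2 (H : Type*) [NormedAddCommGroup H] [InnerProductSpace ℂ H] [RKHS ℂ H X ℂ]
    (μ : Measure X) : Prop :=
  ∀ f : H, MemLp (f : X → ℂ) 2 μ ∧ eLpNorm (f : X → ℂ) 2 μ = ‖f‖ₑ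

end Kernels

end PickDual

end

/-! Necessity is the usual kernel argument: the adjoint of multiplication by φ on A²(ν) multiplies
each kernel vector k_x by conj φ(x), and it is a contraction when |φ| ≤ 1.

For sufficiency, weak-* closedness makes A a dual space, so the functions in A bounded by 1 form a
pointwise compact convex set (`isCompact_symbolBall`). If w is not among their values at the x_i,
Hahn–Banach gives coefficients c with Re ∑ c_i w_i > N, where N bounds the norm of φ ↦ ∑ c_i φ(x_i).
Suppose this functional is T ↦ ⟨T f, g⟩ with f nonzero at every x_i and ‖f‖‖g‖ close to N. Then the
Pick condition for the single measure |f|²μ yields |∑ c_i w_i| ≤ ‖f‖‖g‖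
(`norm_sum_mul_le_of_posSemidef`), a contradiction in the limit.

The core is thus a factorization of functionals through one pair of vectors with nearly optimal
norms (`exists_eq_vectorFunctional_near`). It is built by successive corrections. A functional R of
norm one in the predual is close to a finite sum ∑ ⟨T U_j, V_j⟩. The U_j may be chosen nearly
orthogonal to prescribed vectors, because powers of a multiplier of norm one and modulus less than
one tend to zero pointwise but keep norm one. An operator Φ that nearly norms R allows V_j to be
replaced by Φ U_j, and then only the density ∑ |U_j|² matters. Averaging over signs finds w = ∑ ±
U_j for which a small multiple of |w|² removes part of this density at nearly no waste
(`exists_signSum`). Near orthogonality makes the cross terms negligible, so the corrections add up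
and converge.

Modulus less than one comes from a maximum principle, valid on the components cut out by the
indicator functions in A (`eq_of_norm_eq_one_of_mem_component`). Where A is constant on a component
the factorization is explicit, and interpolants on different components are glued with indicators.
-/

noncomputable section

namespace PickDual

/-! ### The predual of a dual algebra -/

section Predual

variable {H : Type*} [NormedAddCommGroup H] [InnerProductSpace ℂ H]

/-- The normed space underlying an algebra `A` of operators. -/
def OpSpace (A : Subalgebra ℂ (H →L[ℂ] H)) : Type _ := A

instance (A : Subalgebra ℂ (H →L[ℂ] H)) : NormedAddCommGroup (OpSpace A) :=
  inferInstanceAs (NormedAddCommGroup A.toSubmodule)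

instance (A : Subalgebra ℂ (H →L[ℂ] H)) : NormedSpace ℂ (OpSpace A) :=
  inferInstanceAs (NormedSpace ℂ A.toSubmodule)

/-- The inclusion of `A` into `B(H)`. -/
def OpSpace.op {A : Subalgebra ℂ (H →L[ℂ] H)} : OpSpace A →ₗᵢ[ℂ] (H →L[ℂ] H) where
  toFun T := T.1
  map_add' _ _ := rfl
  map_smul' _ _ := rfl
  norm_map' _ := rfl

/-- A member of `A` as a point of the normed space underlying `A`. -/
def OpSpace.of {A : Subalgebra ℂ (H →L[ℂ] H)} (T : H →L[ℂ] H) (hT : T ∈ A) : OpSpace A := ⟨T, hT⟩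

@[simp]
lemma OpSpace.op_of {A : Subalgebra ℂ (H →L[ℂ] H)} (T : H →L[ℂ] H) (hT : T ∈ A) :
    OpSpace.op (OpSpace.of T hT) = T := rfl

lemma OpSpace.op_mem {A : Subalgebra ℂ (H →L[ℂ] H)} (T : OpSpace A) : OpSpace.op T ∈ A := T.2

/-- The vector functional `T ↦ ⟨T f, g⟩` on `A`. -/
def vectorFunctional (A : Subalgebra ℂ (H →L[ℂ] H)) (f g : H) : StrongDual ℂ (OpSpace A) :=
  LinearMap.mkContinuous
    { toFun := fun T => inner ℂ g ((OpSpace.op T) f)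
      map_add' := fun S T => by simp
      map_smul' := fun c T => by simp }
    (‖f‖ * ‖g‖) (fun T => by
      refine (norm_inner_le_norm _ _).trans ?_
      have := (OpSpace.op T).le_opNorm f
      calc ‖g‖ * ‖(OpSpace.op T) f‖ ≤ ‖g‖ * (‖(OpSpace.op T)‖ * ‖f‖) := by gcongr
        _ = ‖f‖ * ‖g‖ * ‖T‖ := by rw [LinearIsometry.norm_map]; ring)

variable (A : Subalgebra ℂ (H →L[ℂ] H))

@[simp]
lemma vectorFunctional_apply (f g : H) (T : OpSpace A) :
    vectorFunctional A f g T = inner ℂ g ((OpSpace.op T) f) := rfl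

lemma norm_vectorFunctional_le (f g : H) : ‖vectorFunctional A f g‖ ≤ ‖f‖ * ‖g‖ :=
  LinearMap.mkContinuous_norm_le _ (by positivity) _

lemma vectorFunctional_add_left (f f' g : H) :
    vectorFunctional A (f + f') g = vectorFunctional A f g + vectorFunctional A f' g := by
  ext T; simp

lemma vectorFunctional_add_right (f g g' : H) :
    vectorFunctional A f (g + g') = vectorFunctional A f g + vectorFunctional A f g' := by
  ext T; simp

lemma vectorFunctional_sub_right (f g g' : H) :
    vectorFunctional A f (g - g') = vectorFunctional A f g - vectorFunctional A f g' := by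
  ext T; simp

lemma vectorFunctional_smul_left (c : ℂ) (f g : H) :
    vectorFunctional A (c • f) g = c • vectorFunctional A f g := by
  ext T; simp

lemma vectorFunctional_smul_right (c : ℂ) (f g : H) :
    vectorFunctional A f (c • g) = conj c • vectorFunctional A f g := by
  ext T; simp [mul_comm]

/-- The predual of `A`: the norm closed span of the vector functionals. -/
def predual : Submodule ℂ (StrongDual ℂ (OpSpace A)) :=
  (Submodule.span ℂ {R | ∃ f g : H, vectorFunctional A f g = R}).topologicalClosure

lemma vectorFunctional_mem_predual (f g : H) : vectorFunctional A f g ∈ predual A :=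
  Submodule.le_topologicalClosure _ (Submodule.subset_span ⟨f, g, rfl⟩)

/-- A functional on the dual of `A` is represented, on vector functionals, by an operator. -/
lemma exists_operator_of_bidual [CompleteSpace H] (ξ : StrongDual ℂ (StrongDual ℂ (OpSpace A))) :
    ∃ T : H →L[ℂ] H, ∀ f g, ξ (vectorFunctional A f g) = inner ℂ g (T f) := by
  let B : H →L⋆[ℂ] H →L[ℂ] ℂ :=
    LinearMap.mkContinuous₂
      (LinearMap.mk₂'ₛₗ (starRingEnd ℂ) (RingHom.id ℂ)
        (fun g f => ξ (vectorFunctional A f g))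
        (fun g g' f => by rw [vectorFunctional_add_right, map_add])
        (fun c g f => by rw [vectorFunctional_smul_right, map_smul])
        (fun g f f' => by rw [vectorFunctional_add_left, map_add])
        (fun c g f => by rw [vectorFunctional_smul_left, map_smul, RingHom.id_apply]))
      ‖ξ‖ (fun g f => by
        have h1 := ξ.le_opNorm (vectorFunctional A f g)
        have h2 := norm_vectorFunctional_le A f g
        simp only [LinearMap.mk₂'ₛₗ_apply]
        calc _ ≤ ‖ξ‖ * ‖vectorFunctional A f g‖ := h1
          _ ≤ ‖ξ‖ * (‖f‖ * ‖g‖) := by gcongr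
          _ = _ := by ring)
  -- The operator representing the bounded sesquilinear form `B` acts on `g`; the adjoint moves it
  -- to `f`.
  refine ⟨(InnerProductSpace.continuousLinearMapOfBilin B).adjoint, fun f g => ?_⟩
  rw [ContinuousLinearMap.adjoint_inner_right,
    InnerProductSpace.continuousLinearMapOfBilin_apply]
  rfl

variable {A}

lemma SqSummablePair.summable_mul_norm {H : Type*} [NormedAddCommGroup H] (p : SqSummablePair H) :
    Summable fun n => ‖p.1.1 n‖ * ‖p.1.2 n‖ := by
  refine Summable.of_nonneg_of_le (fun n => by positivity) (fun n => ?_) (p.2.1.add p.2.2)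
  nlinarith [sq_nonneg (‖p.1.1 n‖ - ‖p.1.2 n‖), sq_nonneg (‖p.1.1 n‖), sq_nonneg (‖p.1.2 n‖)]

lemma SqSummablePair.summable_vectorFunctional (A : Subalgebra ℂ (H →L[ℂ] H))
    (p : SqSummablePair H) :
    Summable fun n => vectorFunctional A (p.1.1 n) (p.1.2 n) :=
  Summable.of_norm_bounded p.summable_mul_norm fun _ => norm_vectorFunctional_le A _ _

/-- For a weak-* closed space `A` the operator representing a functional on the dual lies in `A`. -/
lemma exists_mem_of_bidual [CompleteSpace H] (hA : IsDualAlgebra A)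
    (ξ : StrongDual ℂ (StrongDual ℂ (OpSpace A))) :
    ∃ T : OpSpace A, ∀ f g, ξ (vectorFunctional A f g) = vectorFunctional A f g T := by
  obtain ⟨T, hT⟩ := exists_operator_of_bidual A ξ
  suffices hTA : T ∈ A from ⟨OpSpace.of T hTA, fun f g => hT f g⟩
  let Θ : (H →L[ℂ] H) → SqSummablePair H → ℂ :=
    fun T p => ∑' n, inner ℂ (p.1.2 n) (T (p.1.1 n))
  let ρ : SqSummablePair H → StrongDual ℂ (OpSpace A) := fun p =>
    ∑' n, vectorFunctional A (p.1.1 n) (p.1.2 n)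
  have hρ : ∀ p, ∀ S : OpSpace A, ρ p S = Θ (OpSpace.op S) p := by
    intro p S
    have := (p.summable_vectorFunctional A).hasSum.mapL
      (ContinuousLinearMap.apply ℂ ℂ S)
    exact this.tsum_eq.symm
  have hξρ : ∀ p, ξ (ρ p) = Θ T p := by
    intro p
    have := (p.summable_vectorFunctional A).hasSum.mapL ξ
    rw [← this.tsum_eq]
    exact tsum_congr fun n => hT _ _
  have hΘ : @Topology.IsInducing _ _ (weakStarTopology H) _ Θ :=
    @Topology.IsInducing.mk _ _ (weakStarTopology H) _ Θ rfl
  have hcl : Θ ⁻¹' closure (Θ '' A) = A := by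
    rw [← @Topology.IsInducing.closure_eq_preimage_closure_image _ _ Θ _ (weakStarTopology H) hΘ]
    exact @IsClosed.closure_eq _ (weakStarTopology H) _ hA
  have : T ∈ Θ ⁻¹' closure (Θ '' A) := by
    rw [Set.mem_preimage, mem_closure_iff_nhds]
    classical
    intro t ht
    rw [nhds_pi, Filter.mem_pi'] at ht
    obtain ⟨I, u, hu, hut⟩ := ht
    let restr : OpSpace A →ₗ[ℂ] (I → ℂ) :=
      LinearMap.pi fun p => (ρ p.1).toLinearMap
    -- On finitely many trace class functionals some member of A agrees with `T` exactly. Otherwise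
    -- a linear form `c` on the finite coordinate space kills the values of A but not those of `T`;
    -- the corresponding combination of the `ρ p` is the zero functional on A, and applying `ξ` to
    -- it shows that `c` kills the values of `T` too.
    have hmem : (fun p : I => Θ T p) ∈ LinearMap.range restr := by
      by_contra hcon
      obtain ⟨c, hc, hle⟩ := Submodule.exists_le_ker_of_notMem hcon
      have hz : ∀ S : OpSpace A, c (fun p : I => ρ p.1 S) = 0 := fun S => hle ⟨S, rfl⟩
      have hcsum : ∀ v : I → ℂ, c v = ∑ p, v p * c (Pi.single p 1) := fun v => by
        conv_lhs => rw [← Finset.univ_sum_single v, map_sum]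
        refine Finset.sum_congr rfl fun p _ => ?_
        rw [← smul_eq_mul, ← map_smul, ← Pi.single_smul, smul_eq_mul, mul_one]
      have h0 : ∑ p : I, c (Pi.single p 1) • ρ p.1 = 0 := by
        ext S
        have := hz S
        rw [hcsum] at this
        simpa [mul_comm] using this
      apply hc
      rw [hcsum]
      have := congrArg ξ h0
      simpa [map_sum, hξρ, mul_comm] using this
    obtain ⟨S, hS⟩ := hmem
    refine ⟨Θ (OpSpace.op S), hut fun p hp => ?_, OpSpace.op S, S.op_mem, rfl⟩
    have := congrFun hS ⟨p, hp⟩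
    have h2 : Θ (OpSpace.op S) p = Θ T p := (hρ p S).symm.trans this
    rw [h2]
    exact mem_of_mem_nhds (hu p)
  rwa [hcl] at this

/-- The dual of the predual of a weak-* closed space of operators is the space itself. -/
lemma exists_mem_eq_apply [CompleteSpace H] (hA : IsDualAlgebra A)
    (ξ : StrongDual ℂ (StrongDual ℂ (OpSpace A))) :
    ∃ T : OpSpace A, ∀ R ∈ predual A, ξ R = R T := by
  obtain ⟨T, hT⟩ := exists_mem_of_bidual hA ξ
  refine ⟨T, fun R hR => ?_⟩
  let d : StrongDual ℂ (StrongDual ℂ (OpSpace A)) := ξ - ContinuousLinearMap.apply ℂ ℂ T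
  have hle : predual A ≤ LinearMap.ker d.toLinearMap := by
    refine Submodule.topologicalClosure_minimal _ (Submodule.span_le.2 ?_) d.isClosed_ker
    rintro _ ⟨f, g, rfl⟩
    simpa [d, sub_eq_zero] using hT f g
  have := hle hR
  simpa [d, sub_eq_zero] using this

end Predual

/-! ### Kernel vectors of H and weak convergence -/

section PointEvaluation

variable {X H : Type*} [NormedAddCommGroup H] [InnerProductSpace ℂ H] [CompleteSpace H]
  [RKHS ℂ H X ℂ]

/-- The reproducing kernel of `H` at `x`. -/
def evalVec (H : Type*) {X : Type*} [NormedAddCommGroup H] [InnerProductSpace ℂ H]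
    [CompleteSpace H] [RKHS ℂ H X ℂ] (x : X) : H :=
  RKHS.kerFun H x (1 : ℂ)

@[simp]
lemma inner_evalVec (x : X) (f : H) : inner ℂ (evalVec H x) f = f x := by
  simp [evalVec]

lemma evalVec_ne_zero {x : X} (h : ∃ f : H, f x ≠ 0) : evalVec H x ≠ 0 := by
  obtain ⟨f, hf⟩ := h
  intro h0
  apply hf
  rw [← inner_evalVec, h0, inner_zero_left]

lemma norm_apply_le_evalVec (x : X) (f : H) : ‖f x‖ ≤ ‖evalVec H x‖ * ‖f‖ := by
  rw [← inner_evalVec]; exact norm_inner_le_norm _ _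

/-- A bounded net in `H` that tends to `0` pointwise tends to `0` weakly. -/
lemma tendsto_inner_zero_of_pointwise {ι : Type*} {l : Filter ι} {u : ι → H} {C : ℝ}
    (hC : ∀ i, ‖u i‖ ≤ C) (hu : ∀ x : X, Filter.Tendsto (fun i => u i x) l (𝓝 0)) (e : H) :
    Filter.Tendsto (fun i => inner ℂ e (u i)) l (𝓝 0) := by
  have hmem : e ∈ (Submodule.span ℂ {RKHS.kerFun H x v | (x : X) (v : ℂ)}).topologicalClosure := by
    rw [RKHS.kerFun_dense]; trivial
  have hspan : ∀ e' ∈ Submodule.span ℂ {RKHS.kerFun H x v | (x : X) (v : ℂ)},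
      Filter.Tendsto (fun i => inner ℂ e' (u i)) l (𝓝 0) := by
    intro e' he'
    induction he' using Submodule.span_induction with
    | mem e' h =>
      obtain ⟨x, v, rfl⟩ := h
      have := (hu x).mul_const (conj v)
      simpa using this
    | zero => simp only [inner_zero_left]; exact tendsto_const_nhds
    | add a b _ _ ha hb => simpa [inner_add_left] using ha.add hb
    | smul c a _ ha => simpa [inner_smul_left] using ha.mul_const (conj c)
  rw [Metric.tendsto_nhds]
  intro ε hε
  have hC' : 0 < |C| + 1 := by positivity
  obtain ⟨e', he', hd⟩ := Metric.mem_closure_iff.1 hmem (ε / (2 * (|C| + 1))) (by positivity)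
  filter_upwards [Metric.tendsto_nhds.1 (hspan e' he') (ε / 2) (by positivity)] with i hi
  rw [dist_zero_right] at hi ⊢
  have h1 : inner ℂ e (u i) = inner ℂ e' (u i) + inner ℂ (e - e') (u i) := by
    rw [← inner_add_left]; simp
  have h2 : ‖inner ℂ (e - e') (u i)‖ ≤ ε / 2 := by
    refine (norm_inner_le_norm _ _).trans ?_
    rw [dist_eq_norm] at hd
    calc ‖e - e'‖ * ‖u i‖ ≤ ε / (2 * (|C| + 1)) * (|C| + 1) := by
          gcongr
          linarith [hC i, le_abs_self C]
      _ = ε / 2 := by field_simp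
  rw [h1]
  linarith [norm_add_le (inner ℂ e' (u i)) (inner ℂ (e - e') (u i))]

end PointEvaluation

/-! ### Multiplication operators and their symbols -/

section MulOp

variable {X H : Type*} [NormedAddCommGroup H] [InnerProductSpace ℂ H] [RKHS ℂ H X ℂ]
  {A : Subalgebra ℂ (H →L[ℂ] H)}

lemma IsMulOp.mul {S T : H →L[ℂ] H} {φ ψ : X → ℂ} (hS : IsMulOp S φ) (hT : IsMulOp T ψ) :
    IsMulOp (S * T) (fun x => φ x * ψ x) := fun f x => by
  rw [mul_apply_eq_comp, hS, hT, mul_assoc]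

lemma IsMulOp.add {S T : H →L[ℂ] H} {φ ψ : X → ℂ} (hS : IsMulOp S φ) (hT : IsMulOp T ψ) :
    IsMulOp (S + T) (fun x => φ x + ψ x) := fun f x => by
  simp [hS f x, hT f x, add_mul]

lemma IsMulOp.sub {S T : H →L[ℂ] H} {φ ψ : X → ℂ} (hS : IsMulOp S φ) (hT : IsMulOp T ψ) :
    IsMulOp (S - T) (fun x => φ x - ψ x) := fun f x => by
  simp [hS f x, hT f x, sub_mul]

lemma IsMulOp.smul {T : H →L[ℂ] H} {ψ : X → ℂ} (c : ℂ) (hT : IsMulOp T ψ) :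
    IsMulOp (c • T) (fun x => c * ψ x) := fun f x => by
  simp [hT f x, mul_assoc]

lemma isMulOp_one : IsMulOp (1 : H →L[ℂ] H) (fun _ : X => (1 : ℂ)) := fun f x => by simp

lemma IsMulOp.pow {T : H →L[ℂ] H} {ψ : X → ℂ} (hT : IsMulOp T ψ) (n : ℕ) :
    IsMulOp (T ^ n) (fun x => ψ x ^ n) := by
  induction n with
  | zero => simpa using isMulOp_one
  | succ n ih => simpa [pow_succ] using ih.mul hT

lemma IsMulOp.eq_of_eq {S T : H →L[ℂ] H} {φ ψ : X → ℂ} (hS : IsMulOp S φ) (hT : IsMulOp T ψ)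
    (h : φ = ψ) : S = T := by
  exact ContinuousLinearMap.ext fun f => RKHS.ext fun x => by rw [hS, hT, h]

lemma IsMulOp.unique (hH : ∀ x : X, ∃ f : H, f x ≠ 0) {T : H →L[ℂ] H} {φ ψ : X → ℂ}
    (hS : IsMulOp T φ) (hT : IsMulOp T ψ) : φ = ψ := by
  funext x
  obtain ⟨f, hf⟩ := hH x
  exact mul_right_cancel₀ hf ((hS f x).symm.trans (hT f x))

lemma mul_mem_symbols {φ ψ : X → ℂ} (hφ : φ ∈ symbols A) (hψ : ψ ∈ symbols A) :
    (fun x => φ x * ψ x) ∈ symbols A := by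
  obtain ⟨S, hS, hSφ⟩ := hφ
  obtain ⟨T, hT, hTψ⟩ := hψ
  exact ⟨S * T, A.mul_mem hS hT, hSφ.mul hTψ⟩

lemma add_mem_symbols {φ ψ : X → ℂ} (hφ : φ ∈ symbols A) (hψ : ψ ∈ symbols A) :
    (fun x => φ x + ψ x) ∈ symbols A := by
  obtain ⟨S, hS, hSφ⟩ := hφ
  obtain ⟨T, hT, hTψ⟩ := hψ
  exact ⟨S + T, A.add_mem hS hT, hSφ.add hTψ⟩

lemma sub_mem_symbols {φ ψ : X → ℂ} (hφ : φ ∈ symbols A) (hψ : ψ ∈ symbols A) :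
    (fun x => φ x - ψ x) ∈ symbols A := by
  obtain ⟨S, hS, hSφ⟩ := hφ
  obtain ⟨T, hT, hTψ⟩ := hψ
  exact ⟨S - T, A.sub_mem hS hT, hSφ.sub hTψ⟩

lemma smul_mem_symbols (c : ℂ) {ψ : X → ℂ} (hψ : ψ ∈ symbols A) :
    (fun x => c * ψ x) ∈ symbols A := by
  obtain ⟨T, hT, hTψ⟩ := hψ
  exact ⟨c • T, A.smul_mem hT c, hTψ.smul c⟩

variable (A) in
lemma one_mem_symbols : (fun _ : X => (1 : ℂ)) ∈ symbols A := ⟨1, A.one_mem, isMulOp_one⟩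

lemma pow_mem_symbols {ψ : X → ℂ} (hψ : ψ ∈ symbols A) (n : ℕ) :
    (fun x => ψ x ^ n) ∈ symbols A := by
  obtain ⟨T, hT, hTψ⟩ := hψ
  exact ⟨T ^ n, A.pow_mem hT n, hTψ.pow n⟩

/-- Apply `T` to the kernel vector k at x: the result has value φ(x)‖k‖² at x, whereas a function h
in H satisfies |h(x)| ≤ ‖k‖‖h‖. -/
lemma IsMulOp.norm_apply_le_opNorm [CompleteSpace H] {T : H →L[ℂ] H} {φ : X → ℂ}
    (hT : IsMulOp T φ) {x : X} (hx : ∃ f : H, f x ≠ 0) : ‖φ x‖ ≤ ‖T‖ := by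
  have hk : 0 < ‖evalVec H x‖ := norm_pos_iff.2 (evalVec_ne_zero hx)
  have h1 : ‖evalVec H x x‖ = ‖evalVec H x‖ ^ 2 := by
    rw [← inner_evalVec, inner_self_eq_norm_sq_to_K]; simp
  have h2 : ‖T (evalVec H x) x‖ ≤ ‖evalVec H x‖ * (‖T‖ * ‖evalVec H x‖) :=
    (norm_apply_le_evalVec x _).trans (by gcongr; exact T.le_opNorm _)
  rw [hT, norm_mul, h1] at h2
  have : ‖φ x‖ * ‖evalVec H x‖ ^ 2 ≤ ‖T‖ * ‖evalVec H x‖ ^ 2 := by linarith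
  exact le_of_mul_le_mul_right this (by positivity)

end MulOp

/-! ### The norm of H as an L² norm -/

section L2

variable {X H : Type*} [MeasurableSpace X] {μ : Measure X} [NormedAddCommGroup H]
  [InnerProductSpace ℂ H] [RKHS ℂ H X ℂ]

lemma IsSubspaceL2.memLp (hL2 : IsSubspaceL2 H μ) (f : H) : MemLp (f : X → ℂ) 2 μ := (hL2 f).1

/-- The inclusion of `H` into `L²(μ)`. -/
def IsSubspaceL2.toL2 (hL2 : IsSubspaceL2 H μ) : H →ₗᵢ[ℂ] Lp ℂ 2 μ where
  toFun f := (hL2.memLp f).toLp f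
  map_add' f g := by
    rw [← MemLp.toLp_add]; exact MemLp.toLp_congr _ _ (by simp)
  map_smul' c f := by
    rw [RingHom.id_apply, ← MemLp.toLp_const_smul]; exact MemLp.toLp_congr _ _ (by simp)
  norm_map' f := by
    change ‖(hL2.memLp f).toLp f‖ = ‖f‖
    rw [Lp.norm_toLp, (hL2 f).2, toReal_enorm]

lemma IsSubspaceL2.inner_eq_integral (hL2 : IsSubspaceL2 H μ) (f g : H) :
    inner ℂ f g = ∫ x, conj (f x) * g x ∂μ := by
  rw [← hL2.toL2.inner_map_map f g, L2.inner_def]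
  refine integral_congr_ae ?_
  filter_upwards [(hL2.memLp f).coeFn_toLp, (hL2.memLp g).coeFn_toLp] with x hf hg
  change inner ℂ (((hL2.memLp f).toLp f : X → ℂ) x) (((hL2.memLp g).toLp g : X → ℂ) x) = _
  rw [hf, hg, RCLike.inner_apply, mul_comm]

lemma IsSubspaceL2.integrable_mul (hL2 : IsSubspaceL2 H μ) (f g : H) :
    Integrable (fun x => conj (f x) * g x) μ := by
  have := L2.integrable_inner (𝕜 := ℂ) (hL2.toL2 f) (hL2.toL2 g)
  refine this.congr ?_
  filter_upwards [(hL2.memLp f).coeFn_toLp, (hL2.memLp g).coeFn_toLp] with x hf hg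
  change inner ℂ (((hL2.memLp f).toLp f : X → ℂ) x) (((hL2.memLp g).toLp g : X → ℂ) x) = _
  rw [hf, hg, RCLike.inner_apply, mul_comm]

lemma IsSubspaceL2.integrable_norm_sq (hL2 : IsSubspaceL2 H μ) (f : H) :
    Integrable (fun x => ‖f x‖ ^ 2) μ :=
  (memLp_two_iff_integrable_sq_norm (hL2.memLp f).1).1 (hL2.memLp f)

lemma IsSubspaceL2.integral_norm_sq (hL2 : IsSubspaceL2 H μ) (f : H) :
    ∫ x, ‖f x‖ ^ 2 ∂μ = ‖f‖ ^ 2 := by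
  have h := hL2.inner_eq_integral f f
  rw [inner_self_eq_norm_sq_to_K] at h
  have h2 : ∀ x, conj (f x) * f x = ((‖f x‖ ^ 2 : ℝ) : ℂ) := fun x => by
    rw [mul_comm, Complex.mul_conj, Complex.normSq_eq_norm_sq]
  simp_rw [h2] at h
  rw [integral_complex_ofReal] at h
  have h3 : ((‖f‖ ^ 2 : ℝ) : ℂ) = ((∫ x, ‖f x‖ ^ 2 ∂μ : ℝ) : ℂ) := by
    rw [← h]; push_cast; rfl
  exact_mod_cast h3.symm

lemma IsSubspaceL2.norm_le_of_norm_apply_le (hL2 : IsSubspaceL2 H μ) {C : ℝ} (hC : 0 ≤ C)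
    {f g : H} (h : ∀ x, ‖f x‖ ≤ C * ‖g x‖) : ‖f‖ ≤ C * ‖g‖ := by
  refine le_of_sq_le_sq ?_ (by positivity)
  rw [mul_pow, ← hL2.integral_norm_sq f, ← hL2.integral_norm_sq g, ← integral_const_mul]
  refine integral_mono (hL2.integrable_norm_sq f) ((hL2.integrable_norm_sq g).const_mul _)
    fun x => ?_
  simp only
  rw [← mul_pow]
  exact pow_le_pow_left₀ (norm_nonneg _) (h x) 2

/-- Here the L² norm enters: together with `IsMulOp.norm_apply_le_opNorm` it makes the operator norm
equal to the supremum over all of X, so that the norm is multiplicative on powers. -/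
lemma IsMulOp.opNorm_le (hL2 : IsSubspaceL2 H μ) {T : H →L[ℂ] H} {φ : X → ℂ}
    (hT : IsMulOp T φ) {C : ℝ} (hC : 0 ≤ C) (h : ∀ x, ‖φ x‖ ≤ C) : ‖T‖ ≤ C :=
  T.opNorm_le_bound hC fun f => hL2.norm_le_of_norm_apply_le hC fun x => by
    rw [hT, norm_mul]; gcongr; exact h x

end L2

/-! ### Pointwise compactness of the unit ball -/

section Compactness

variable {X H : Type*} [MeasurableSpace X] {μ : Measure X} [NormedAddCommGroup H]
  [InnerProductSpace ℂ H] [CompleteSpace H] [RKHS ℂ H X ℂ] {A : Subalgebra ℂ (H →L[ℂ] H)}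

/-- The functions in `A` that are bounded by `1` on `X`. -/
def symbolBall (A : Subalgebra ℂ (H →L[ℂ] H)) : Set (X → ℂ) :=
  {φ ∈ symbols A | ∀ y, ‖φ y‖ ≤ 1}

/-- By Banach–Alaoglu the unit ball of the bidual of A is weak-* compact. Its elements act on vector
functionals like members of A, and point evaluations are multiples of vector functionals, so the
ball maps continuously onto the set in question. -/
lemma isCompact_symbolBall (hL2 : IsSubspaceL2 H μ) (hH : ∀ x : X, ∃ f : H, f x ≠ 0)
    (hA : IsDualAlgebraOfMultipliers A) : IsCompact (symbolBall A) := by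
  choose f hf using hH
  let V := StrongDual ℂ (OpSpace A)
  let Φ : WeakDual ℂ V → X → ℂ := fun ξ y => ξ (vectorFunctional A (f y) (evalVec H y)) / f y y
  have hΦ : Continuous Φ := continuous_pi fun y =>
    (WeakDual.eval_continuous (vectorFunctional A (f y) (evalVec H y))).div_const _
  have hK := WeakDual.isCompact_closedBall (0 : StrongDual ℂ V) 1
  convert hK.image hΦ using 1
  ext φ
  constructor
  · rintro ⟨⟨T, hT, hTφ⟩, hb⟩
    refine ⟨StrongDual.toWeakDual (ContinuousLinearMap.apply ℂ ℂ (OpSpace.of T hT)), ?_, ?_⟩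
    · rw [Set.mem_preimage, mem_closedBall_zero_iff]
      refine ContinuousLinearMap.opNorm_le_bound _ zero_le_one fun R => ?_
      have h1 : ‖OpSpace.of T hT‖ ≤ 1 := by
        rw [← OpSpace.op.norm_map, OpSpace.op_of]
        exact hTφ.opNorm_le hL2 zero_le_one hb
      calc ‖R (OpSpace.of T hT)‖ ≤ ‖R‖ * ‖OpSpace.of T hT‖ := R.le_opNorm _
        _ ≤ ‖R‖ * 1 := by gcongr
        _ = 1 * ‖R‖ := by ring
    · funext y
      change inner ℂ (evalVec H y) (T (f y)) / f y y = φ y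
      rw [inner_evalVec, hTφ, mul_div_cancel_right₀ _ (hf y)]
  · rintro ⟨ξ, hξ, rfl⟩
    obtain ⟨T, hT⟩ := exists_mem_of_bidual hA.isDualAlgebra (WeakDual.toStrongDual ξ)
    obtain ⟨φ, hφ⟩ := hA.subset_multipliers T.op_mem
    have hΦφ : Φ ξ = φ := by
      funext y
      change WeakDual.toStrongDual ξ (vectorFunctional A (f y) (evalVec H y)) / f y y = φ y
      rw [hT, vectorFunctional_apply, inner_evalVec, hφ, mul_div_cancel_right₀ _ (hf y)]
    rw [hΦφ]
    refine ⟨⟨_, T.op_mem, hφ⟩, fun y => (hφ.norm_apply_le_opNorm ⟨f y, hf y⟩).trans ?_⟩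
    refine ContinuousLinearMap.opNorm_le_bound _ zero_le_one fun u => ?_
    rw [Set.mem_preimage, mem_closedBall_zero_iff] at hξ
    -- Testing `ξ` on the vector functional of the pair (u, Tu) bounds the norm of `T` by that of
    -- `ξ`.
    have h1 : ‖OpSpace.op T u‖ ^ 2 ≤ ‖u‖ * ‖OpSpace.op T u‖ := by
      have h2 := (WeakDual.toStrongDual ξ).le_opNorm (vectorFunctional A u (OpSpace.op T u))
      rw [hT, vectorFunctional_apply, inner_self_eq_norm_sq_to_K] at h2
      have h3 : ‖(WeakDual.toStrongDual ξ)‖ * ‖vectorFunctional A u (OpSpace.op T u)‖ ≤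
          1 * (‖u‖ * ‖OpSpace.op T u‖) := by
        gcongr
        exact norm_vectorFunctional_le A _ _
      simpa using h2.trans h3
    rw [one_mul]
    by_cases h0 : ‖OpSpace.op T u‖ = 0
    · rw [h0]; positivity
    · have : 0 < ‖OpSpace.op T u‖ := lt_of_le_of_ne (norm_nonneg _) (Ne.symm h0)
      rw [sq] at h1
      exact le_of_mul_le_mul_right h1 this

lemma mem_symbolBall_of_tendsto (hL2 : IsSubspaceL2 H μ) (hH : ∀ x : X, ∃ f : H, f x ≠ 0)
    (hA : IsDualAlgebraOfMultipliers A) {φ : ℕ → X → ℂ} (hφ : ∀ n, φ n ∈ symbolBall A)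
    {ψ : X → ℂ} (h : ∀ x, Filter.Tendsto (fun n => φ n x) Filter.atTop (𝓝 (ψ x))) :
    ψ ∈ symbolBall A :=
  (isCompact_symbolBall hL2 hH hA).isClosed.mem_of_tendsto (tendsto_pi_nhds.2 h)
    (Filter.Eventually.of_forall hφ)

end Compactness

/-! ### Components and the maximum principle -/

section Components

variable {X H : Type*} [NormedAddCommGroup H] [InnerProductSpace ℂ H] [RKHS ℂ H X ℂ]
  {A : Subalgebra ℂ (H →L[ℂ] H)}

/-- The sets whose indicator function belongs to `A`. -/
def IsClopenFor (A : Subalgebra ℂ (H →L[ℂ] H)) (E : Set X) : Prop :=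
  E.indicator (fun _ => (1 : ℂ)) ∈ symbols A

/-- The component of `x`: the intersection of all sets containing `x` whose indicator function
belongs to `A`. -/
def component (A : Subalgebra ℂ (H →L[ℂ] H)) (x : X) : Set X :=
  ⋂₀ {E | IsClopenFor A E ∧ x ∈ E}

lemma mem_component_self (A : Subalgebra ℂ (H →L[ℂ] H)) (x : X) : x ∈ component A x :=
  Set.mem_sInter.2 fun _ h => h.2

lemma component_subset {E : Set X} {x : X} (hE : IsClopenFor A E) (hx : x ∈ E) :
    component A x ⊆ E := Set.sInter_subset_of_mem ⟨hE, hx⟩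

lemma IsClopenFor.inter {E F : Set X} (hE : IsClopenFor A E) (hF : IsClopenFor A F) :
    IsClopenFor A (E ∩ F) := by
  have := mul_mem_symbols hE hF
  rw [IsClopenFor]
  convert this using 1
  funext x
  by_cases h1 : x ∈ E <;> by_cases h2 : x ∈ F <;> simp [h1, h2]

lemma IsClopenFor.diff {E F : Set X} (hE : IsClopenFor A E) (hF : IsClopenFor A F) :
    IsClopenFor A (E \ F) := by
  have := sub_mem_symbols hE (mul_mem_symbols hE hF)
  rw [IsClopenFor]
  convert this using 1
  funext x
  by_cases h1 : x ∈ E <;> by_cases h2 : x ∈ F <;> simp [h1, h2]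

lemma isClopenFor_univ (A : Subalgebra ℂ (H →L[ℂ] H)) : IsClopenFor A (Set.univ : Set X) := by
  rw [IsClopenFor, Set.indicator_univ]; exact one_mem_symbols A

lemma norm_indicator_one_le {X : Type*} (E : Set X) (y : X) :
    ‖E.indicator (fun _ => (1 : ℂ)) y‖ ≤ 1 := by
  by_cases h : y ∈ E <;> simp [h]

variable [MeasurableSpace X] {μ : Measure X} [CompleteSpace H]

/-- On any finite set of points the component agrees with a finite intersection of sets whose
indicators lie in A. Its indicator is therefore a pointwise limit point of the compact unit ball,
however many sets are being intersected. -/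
lemma isClopenFor_component (hL2 : IsSubspaceL2 H μ) (hH : ∀ x : X, ∃ f : H, f x ≠ 0)
    (hA : IsDualAlgebraOfMultipliers A) (x : X) : IsClopenFor A (component A x) := by
  have hcl := (isCompact_symbolBall hL2 hH hA).isClosed
  suffices h : (component A x).indicator (fun _ => (1 : ℂ)) ∈ closure (symbolBall A) by
    rw [hcl.closure_eq] at h; exact h.1
  rw [mem_closure_iff_nhds]
  intro t ht
  rw [nhds_pi, Filter.mem_pi'] at ht
  obtain ⟨I, u, hu, hut⟩ := ht
  have hex : ∀ s : Finset X, ∃ E : Set X, IsClopenFor A E ∧ x ∈ E ∧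
      ∀ y ∈ s, y ∉ component A x → y ∉ E := by
    intro s
    classical
    induction s using Finset.induction_on with
    | empty => exact ⟨Set.univ, isClopenFor_univ A, trivial, by simp⟩
    | insert y s _ ih =>
      obtain ⟨E, hE, hxE, hs⟩ := ih
      by_cases hy : y ∈ component A x
      · refine ⟨E, hE, hxE, fun z hz hzc => ?_⟩
        rcases Finset.mem_insert.1 hz with rfl | hz
        · exact absurd hy hzc
        · exact hs z hz hzc
      · have : ∃ F, (IsClopenFor A F ∧ x ∈ F) ∧ y ∉ F := by
          by_contra hcon
          push Not at hcon
          exact hy (Set.mem_sInter.2 fun F hF => hcon F hF)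
        obtain ⟨F, ⟨hF, hxF⟩, hyF⟩ := this
        refine ⟨E ∩ F, hE.inter hF, ⟨hxE, hxF⟩, fun z hz hzc => ?_⟩
        rcases Finset.mem_insert.1 hz with rfl | hz
        · exact fun h => hyF h.2
        · exact fun h => hs z hz hzc h.1
  obtain ⟨E, hE, hxE, hI⟩ := hex I
  refine ⟨E.indicator fun _ => 1, hut fun y hy => ?_, hE, norm_indicator_one_le E⟩
  have : E.indicator (fun _ => (1 : ℂ)) y = (component A x).indicator (fun _ => (1 : ℂ)) y := by
    by_cases hyc : y ∈ component A x
    · simp [hyc, component_subset hE hxE hyc]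
    · simp [hyc, hI y hy hyc]
  rw [this]
  exact mem_of_mem_nhds (hu y)

lemma norm_half_one_add_lt_one {a : ℂ} (ha : ‖a‖ ≤ 1) (h1 : a ≠ 1) : ‖(1 + a) / 2‖ < 1 := by
  rw [norm_div, div_lt_one (by simp)]
  simp only [Complex.norm_ofNat]
  by_contra hcon
  push Not at hcon
  have h2 : ‖(1 : ℂ) + a‖ = ‖(1 : ℂ)‖ + ‖a‖ := by
    apply le_antisymm (norm_add_le _ _)
    rw [norm_one]; linarith
  have h3 : ‖a‖ = 1 := by
    have := norm_add_le (1 : ℂ) a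
    rw [norm_one] at this; linarith
  have h4 := sameRay_iff_norm_add.2 h2
  exact h1 (h4.norm_eq_iff.1 (by rw [norm_one, h3])).symm

/-- The maximum principle on a component. -/
lemma eq_of_norm_eq_one_of_mem_component (hL2 : IsSubspaceL2 H μ)
    (hH : ∀ x : X, ∃ f : H, f x ≠ 0) (hA : IsDualAlgebraOfMultipliers A) {x : X} {ψ : X → ℂ}
    (hψ : ψ ∈ symbols A) (hb : ∀ y ∈ component A x, ‖ψ y‖ ≤ 1) {y : X} (hy : y ∈ component A x)
    (hy1 : ‖ψ y‖ = 1) : ∀ z ∈ component A x, ψ z = ψ y := by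
  set E := component A x with hEdef
  have hE : IsClopenFor A E := isClopenFor_component hL2 hH hA x
  -- A peaking function: it equals 1 exactly where ψ takes the value ψ(y) on the component and has
  -- modulus less than 1 elsewhere. Its powers converge to the indicator of that level set, which
  -- hence belongs to A.
  let θ : X → ℂ := fun z => E.indicator (fun _ => (1 : ℂ)) z * ((1 + conj (ψ y) * ψ z) / 2)
  have hθ : θ ∈ symbols A := by
    have h1 := smul_mem_symbols (1 / 2)
      (add_mem_symbols (one_mem_symbols A) (smul_mem_symbols (conj (ψ y)) hψ))
    have h2 := mul_mem_symbols hE h1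
    convert h2 using 1
    funext z
    simp only [θ]; ring
  have hle : ∀ z ∈ E, ‖conj (ψ y) * ψ z‖ ≤ 1 := fun z hz => by
    rw [norm_mul, RCLike.norm_conj, hy1, one_mul]; exact hb z hz
  have hyy : conj (ψ y) * ψ y = 1 := by
    rw [mul_comm, Complex.mul_conj, Complex.normSq_eq_norm_sq, hy1]; simp
  have heq : ∀ z, conj (ψ y) * ψ z = 1 ↔ ψ z = ψ y := fun z => by
    have h0 : conj (ψ y) ≠ 0 := left_ne_zero_of_mul_eq_one hyy
    constructor
    · intro h; exact mul_left_cancel₀ h0 (h.trans hyy.symm)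
    · intro h; rw [h, hyy]
  have hθ1 : ∀ z, ‖θ z‖ ≤ 1 := fun z => by
    by_cases hz : z ∈ E
    · simp only [θ, Set.indicator_of_mem hz, one_mul]
      by_cases h1 : conj (ψ y) * ψ z = 1
      · rw [h1]; norm_num
      · exact (norm_half_one_add_lt_one (hle z hz) h1).le
    · simp [θ, hz]
  let F : Set X := {z ∈ E | ψ z = ψ y}
  have hF : F.indicator (fun _ => (1 : ℂ)) ∈ symbolBall A := by
    refine mem_symbolBall_of_tendsto hL2 hH hA (φ := fun n z => θ z ^ (n + 1))
      (fun n => ⟨pow_mem_symbols hθ (n + 1), fun z => ?_⟩) fun z => ?_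
    · rw [norm_pow]; exact pow_le_one₀ (norm_nonneg _) (hθ1 z)
    · by_cases hz : z ∈ F
      · have : θ z = 1 := by
          simp only [θ, Set.indicator_of_mem hz.1, one_mul]
          rw [(heq z).2 hz.2]; norm_num
        simp [this, hz]
      · rw [Set.indicator_of_notMem hz]
        have hlt : ‖θ z‖ < 1 := by
          by_cases hzE : z ∈ E
          · simp only [θ, Set.indicator_of_mem hzE, one_mul]
            exact norm_half_one_add_lt_one (hle z hzE) fun h => hz ⟨hzE, (heq z).1 h⟩
          · simp [θ, hzE]
        exact (tendsto_pow_atTop_nhds_zero_of_norm_lt_one hlt).comp (Filter.tendsto_add_atTop_nat 1)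
  have hFc : IsClopenFor A F := hF.1
  intro z hz
  -- The level set cannot split the component: if it missed `x`, the component would lie in `E \ F`,
  -- yet it contains `y`.
  by_cases hxF : x ∈ F
  · exact (component_subset hFc hxF hz).2
  · have := component_subset (hE.diff hFc) ⟨mem_component_self A x, hxF⟩ hy
    exact absurd ⟨hy, rfl⟩ this.2

end Components

/-! ### Moments of random signed sums -/

section Signs

variable {ι : Type*} [DecidableEq ι]

/-- The sum of the `z j`, `j ∈ s`, with sign `+` for `j ∈ t` and `-` otherwise. -/
def signSum {M : Type*} [AddCommGroup M] (z : ι → M) (s t : Finset ι) : M :=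
  ∑ j ∈ s, if j ∈ t then z j else -z j

lemma signSum_insert_of_notMem {M : Type*} [AddCommGroup M] (z : ι → M) {a : ι} {s t : Finset ι}
    (ha : a ∉ s) (ht : t ⊆ s) : signSum z (insert a s) t = signSum z s t - z a := by
  rw [signSum, Finset.sum_insert ha, if_neg fun h => ha (ht h), signSum]
  abel

lemma signSum_insert_insert {M : Type*} [AddCommGroup M] (z : ι → M) {a : ι} {s t : Finset ι}
    (ha : a ∉ s) : signSum z (insert a s) (insert a t) = signSum z s t + z a := by
  rw [signSum, Finset.sum_insert ha, if_pos (Finset.mem_insert_self a t), signSum, add_comm]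
  congr 1
  refine Finset.sum_congr rfl fun j hj => ?_
  have : j ≠ a := fun h => ha (h ▸ hj)
  simp [this]

lemma norm_sq_sub_add_norm_sq_add (u z : ℂ) :
    ‖u - z‖ ^ 2 + ‖u + z‖ ^ 2 = 2 * (‖u‖ ^ 2 + ‖z‖ ^ 2) := by
  have := parallelogram_law_with_norm ℂ u z
  nlinarith

lemma norm_pow_four_sub_add_le (u z : ℂ) :
    ‖u - z‖ ^ 4 + ‖u + z‖ ^ 4 ≤ 2 * (‖u‖ ^ 4 + 6 * ‖u‖ ^ 2 * ‖z‖ ^ 2 + ‖z‖ ^ 4) := by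
  have h1 := norm_sq_sub_add_norm_sq_add u z
  have h2 : ‖u + z‖ ^ 2 - ‖u - z‖ ^ 2 = 4 * (inner ℝ u z) := by
    rw [norm_add_sq_real, norm_sub_sq_real]; ring
  have h3 : (inner ℝ u z) ^ 2 ≤ ‖u‖ ^ 2 * ‖z‖ ^ 2 := by
    rw [← mul_pow, ← sq_abs]
    exact pow_le_pow_left₀ (abs_nonneg _) (abs_real_inner_le_norm u z) 2
  have h4 : ‖u - z‖ ^ 4 + ‖u + z‖ ^ 4 =
      ((‖u - z‖ ^ 2 + ‖u + z‖ ^ 2) ^ 2 + (‖u + z‖ ^ 2 - ‖u - z‖ ^ 2) ^ 2) / 2 := by ring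
  rw [h4, h1, h2]
  nlinarith

lemma sum_norm_sq_signSum (z : ι → ℂ) (s : Finset ι) :
    ∑ t ∈ s.powerset, ‖signSum z s t‖ ^ 2 = 2 ^ s.card * ∑ j ∈ s, ‖z j‖ ^ 2 := by
  induction s using Finset.induction_on with
  | empty => simp [signSum]
  | insert a s ha ih =>
    rw [Finset.sum_powerset_insert ha, ← Finset.sum_add_distrib, Finset.card_insert_of_notMem ha,
      Finset.sum_insert ha]
    have : ∀ t ∈ s.powerset, ‖signSum z (insert a s) t‖ ^ 2 +
        ‖signSum z (insert a s) (insert a t)‖ ^ 2 = 2 * (‖signSum z s t‖ ^ 2 + ‖z a‖ ^ 2) := by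
      intro t ht
      rw [signSum_insert_of_notMem z ha (Finset.mem_powerset.1 ht), signSum_insert_insert z ha,
        norm_sq_sub_add_norm_sq_add]
    rw [Finset.sum_congr rfl this, ← Finset.mul_sum, Finset.sum_add_distrib, ih,
      Finset.sum_const, Finset.card_powerset, nsmul_eq_mul]
    push_cast
    ring

/-- Khintchine's inequality for the fourth moment, by induction on the number of terms. -/
lemma sum_norm_pow_four_signSum_le (z : ι → ℂ) (s : Finset ι) :
    ∑ t ∈ s.powerset, ‖signSum z s t‖ ^ 4 ≤ 3 * 2 ^ s.card * (∑ j ∈ s, ‖z j‖ ^ 2) ^ 2 := by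
  induction s using Finset.induction_on with
  | empty => simp [signSum]
  | insert a s ha ih =>
    rw [Finset.sum_powerset_insert ha, ← Finset.sum_add_distrib, Finset.card_insert_of_notMem ha,
      Finset.sum_insert ha]
    have : ∀ t ∈ s.powerset, ‖signSum z (insert a s) t‖ ^ 4 +
        ‖signSum z (insert a s) (insert a t)‖ ^ 4 ≤
        2 * (‖signSum z s t‖ ^ 4 + ‖signSum z s t‖ ^ 2 * (6 * ‖z a‖ ^ 2) + ‖z a‖ ^ 4) := by
      intro t ht
      rw [signSum_insert_of_notMem z ha (Finset.mem_powerset.1 ht), signSum_insert_insert z ha]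
      refine (norm_pow_four_sub_add_le _ _).trans (le_of_eq ?_)
      ring
    refine (Finset.sum_le_sum this).trans ?_
    rw [← Finset.mul_sum, Finset.sum_add_distrib, Finset.sum_add_distrib, ← Finset.sum_mul,
      sum_norm_sq_signSum, Finset.sum_const, Finset.card_powerset, nsmul_eq_mul]
    push_cast
    have hN : (0 : ℝ) < 2 ^ s.card := by positivity
    set P := ∑ j ∈ s, ‖z j‖ ^ 2
    have hb : 0 ≤ ‖z a‖ ^ 4 := by positivity
    have hNb := mul_nonneg hN.le hb
    rw [pow_succ' (2 : ℝ) s.card]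
    nlinarith

lemma sum_norm_signSum_le (z : ι → ℂ) (s : Finset ι) :
    ∑ t ∈ s.powerset, ‖signSum z s t‖ ≤ 2 ^ s.card * √(∑ j ∈ s, ‖z j‖ ^ 2) := by
  have hP : 0 ≤ ∑ j ∈ s, ‖z j‖ ^ 2 := Finset.sum_nonneg fun _ _ => by positivity
  refine le_of_sq_le_sq ?_ (by positivity)
  refine (sq_sum_le_card_mul_sum_sq (s := s.powerset)).trans (le_of_eq ?_)
  rw [sum_norm_sq_signSum, mul_pow, Real.sq_sqrt hP, Finset.card_powerset]
  push_cast
  ring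

/-- With P = ∑ |z_j|² and a the squared modulus of a signed sum, the mean of a is P and that of a²
is at most 3P². The modulus is handled by a quadratic majorant of |P - la|P, so the gain is linear
in l and the loss only quadratic. -/
lemma sum_abs_sub_signSum_le (z : ι → ℂ) (s : Finset ι) (l : ℝ) :
    ∑ t ∈ s.powerset, |∑ j ∈ s, ‖z j‖ ^ 2 - l * ‖signSum z s t‖ ^ 2| ≤
      2 ^ s.card * ((1 - l + 3 / 2 * l ^ 2) * ∑ j ∈ s, ‖z j‖ ^ 2) := by
  set P := ∑ j ∈ s, ‖z j‖ ^ 2 with hPdef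
  have hP : 0 ≤ P := Finset.sum_nonneg fun _ _ => by positivity
  have h2 := sum_norm_sq_signSum z s
  have h4 := sum_norm_pow_four_signSum_le z s
  rw [← hPdef] at h2 h4
  -- When P < la the difference of the two sides is (2P - la)²/2.
  have hpt : ∀ a : ℝ, |P - l * a| * P ≤ P ^ 2 - P * l * a + l ^ 2 / 2 * a ^ 2 := by
    intro a
    rcases abs_cases (P - l * a) with ⟨h, _⟩ | ⟨h, _⟩ <;> rw [h] <;>
      nlinarith [sq_nonneg (2 * P - l * a), sq_nonneg (l * a)]
  rcases hP.eq_or_lt with h0 | hpos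
  · rw [← h0] at h2 ⊢
    have hz : ∀ t ∈ s.powerset, ‖signSum z s t‖ ^ 2 = 0 :=
      (Finset.sum_eq_zero_iff_of_nonneg fun _ _ => by positivity).1 (by rw [h2, mul_zero])
    rw [Finset.sum_eq_zero fun t ht => by rw [hz t ht]; simp]
    simp
  · refine le_of_mul_le_mul_right ?_ hpos
    rw [Finset.sum_mul]
    refine (Finset.sum_le_sum fun t _ => hpt (‖signSum z s t‖ ^ 2)).trans ?_
    rw [Finset.sum_add_distrib, Finset.sum_sub_distrib, ← Finset.mul_sum, ← Finset.mul_sum, h2,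
      Finset.sum_const, Finset.card_powerset, nsmul_eq_mul]
    have h4' : ∑ t ∈ s.powerset, (‖signSum z s t‖ ^ 2) ^ 2 ≤ 3 * 2 ^ s.card * P ^ 2 := by
      refine le_trans (le_of_eq (Finset.sum_congr rfl fun t _ => by ring)) h4
    push_cast
    have : l ^ 2 / 2 * ∑ t ∈ s.powerset, (‖signSum z s t‖ ^ 2) ^ 2 ≤
        l ^ 2 / 2 * (3 * 2 ^ s.card * P ^ 2) := by gcongr
    linarith

end Signs

/-! ### Choosing the signs -/

section SignSelection

section Coe

variable {X H : Type*} [NormedAddCommGroup H] [InnerProductSpace ℂ H] [RKHS ℂ H X ℂ]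

lemma coe_sum_apply {ι : Type*} (U : ι → H) (s : Finset ι) (x : X) :
    (∑ j ∈ s, U j) x = ∑ j ∈ s, U j x := by
  classical
  induction s using Finset.induction_on with
  | empty => simp
  | insert a s ha ih => simp [Finset.sum_insert ha, ih]

lemma signSum_apply {ι : Type*} [DecidableEq ι] (U : ι → H) (s t : Finset ι) (x : X) :
    (signSum U s t) x = signSum (fun j => U j x) s t := by
  rw [signSum, coe_sum_apply, signSum]
  refine Finset.sum_congr rfl fun j _ => ?_
  split_ifs <;> simp

end Coe

variable {X H : Type*} [MeasurableSpace X] {μ : Measure X} [NormedAddCommGroup H]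
  [InnerProductSpace ℂ H] [RKHS ℂ H X ℂ]

lemma IsSubspaceL2.integrable_sum_norm_sq {ι : Type*} [Fintype ι] (hL2 : IsSubspaceL2 H μ)
    (U : ι → H) : Integrable (fun x => ∑ j, ‖U j x‖ ^ 2) μ :=
  integrable_finsetSum _ fun j _ => hL2.integrable_norm_sq (U j)

lemma IsSubspaceL2.integral_sum_norm_sq {ι : Type*} [Fintype ι] (hL2 : IsSubspaceL2 H μ)
    (U : ι → H) : ∫ x, ∑ j, ‖U j x‖ ^ 2 ∂μ = ∑ j, ‖U j‖ ^ 2 := by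
  rw [integral_finsetSum _ fun j _ => hL2.integrable_norm_sq (U j)]
  exact Finset.sum_congr rfl fun j _ => hL2.integral_norm_sq (U j)

lemma IsSubspaceL2.memLp_sqrt_sum_norm_sq {ι : Type*} [Fintype ι] (hL2 : IsSubspaceL2 H μ)
    (U : ι → H) : MemLp (fun x => √(∑ j, ‖U j x‖ ^ 2)) 2 μ := by
  have hm : AEStronglyMeasurable (fun x => √(∑ j, ‖U j x‖ ^ 2)) μ :=
    Real.continuous_sqrt.comp_aestronglyMeasurable (hL2.integrable_sum_norm_sq U).1
  rw [memLp_two_iff_integrable_sq_norm hm]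
  refine (hL2.integrable_sum_norm_sq U).congr (Filter.Eventually.of_forall fun x => ?_)
  simp only [Real.norm_eq_abs, sq_abs]
  rw [Real.sq_sqrt (Finset.sum_nonneg fun _ _ => by positivity)]

/-- Among all combinations `∑ ± U j` there is one whose squared modulus, scaled by `l`, uses up a
fixed portion of `∑ |U j|²` efficiently. -/
lemma exists_signSum (hL2 : IsSubspaceL2 H μ) {ι : Type*} [Fintype ι] [DecidableEq ι]
    (U : ι → H) {F : X → ℝ} (hF : MemLp F 2 μ) (hF0 : ∀ x, 0 ≤ F x) {l η D : ℝ}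
    (hD : 0 ≤ D) :
    ∃ t : Finset ι,
      ∫ x, |∑ j, ‖U j x‖ ^ 2 - l * ‖signSum U Finset.univ t x‖ ^ 2| ∂μ +
        (1 - η) * (l * ‖signSum U Finset.univ t‖ ^ 2) +
        D * ∫ x, ‖signSum U Finset.univ t x‖ * F x ∂μ ≤
      (1 - η * l + 3 / 2 * l ^ 2) * ∑ j, ‖U j‖ ^ 2 +
        D * ∫ x, √(∑ j, ‖U j x‖ ^ 2) * F x ∂μ := by
  let u : Finset ι → H := fun t => signSum U Finset.univ t
  have hi1 : ∀ t, Integrable (fun x => |∑ j, ‖U j x‖ ^ 2 - l * ‖u t x‖ ^ 2|) μ := fun t =>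
    ((hL2.integrable_sum_norm_sq U).sub ((hL2.integrable_norm_sq (u t)).const_mul l)).abs
  have hi2 : ∀ t, Integrable (fun x => ‖u t x‖ * F x) μ := fun t =>
    (hL2.memLp (u t)).norm.integrable_mul hF
  have hi3 : Integrable (fun x => √(∑ j, ‖U j x‖ ^ 2) * F x) μ :=
    (hL2.memLp_sqrt_sum_norm_sq U).integrable_mul hF
  let G : Finset ι → ℝ := fun t => ∫ x, |∑ j, ‖U j x‖ ^ 2 - l * ‖u t x‖ ^ 2| ∂μ +
        (1 - η) * (l * ‖u t‖ ^ 2) + D * ∫ x, ‖u t x‖ * F x ∂μ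
  let B : ℝ := (1 - η * l + 3 / 2 * l ^ 2) * ∑ j, ‖U j‖ ^ 2 +
        D * ∫ x, √(∑ j, ‖U j x‖ ^ 2) * F x ∂μ
  have hcard : ((Finset.univ : Finset ι).powerset.card : ℝ) = 2 ^ (Finset.univ : Finset ι).card := by
    rw [Finset.card_powerset]; push_cast; rfl
  have h1 : ∑ t ∈ (Finset.univ : Finset ι).powerset,
      ∫ x, |∑ j, ‖U j x‖ ^ 2 - l * ‖u t x‖ ^ 2| ∂μ ≤
      2 ^ (Finset.univ : Finset ι).card * ((1 - l + 3 / 2 * l ^ 2) * ∑ j, ‖U j‖ ^ 2) := by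
    rw [← integral_finsetSum _ fun t _ => hi1 t, ← hL2.integral_sum_norm_sq U,
      ← integral_const_mul, ← integral_const_mul]
    refine integral_mono (integrable_finsetSum _ fun t _ => hi1 t)
      (((hL2.integrable_sum_norm_sq U).const_mul _).const_mul _) fun x => ?_
    have := sum_abs_sub_signSum_le (fun j => U j x) Finset.univ l
    simpa only [u, signSum_apply] using this
  have h2 : ∑ t ∈ (Finset.univ : Finset ι).powerset, ‖u t‖ ^ 2 =
      2 ^ (Finset.univ : Finset ι).card * ∑ j, ‖U j‖ ^ 2 := by
    simp_rw [← hL2.integral_norm_sq]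
    rw [← integral_finsetSum _ fun t _ => hL2.integrable_norm_sq (u t),
      ← integral_finsetSum _ fun j _ => hL2.integrable_norm_sq (U j), ← integral_const_mul]
    refine integral_congr_ae (Filter.Eventually.of_forall fun x => ?_)
    have := sum_norm_sq_signSum (fun j => U j x) Finset.univ
    simpa only [u, signSum_apply] using this
  have h3 : ∑ t ∈ (Finset.univ : Finset ι).powerset, ∫ x, ‖u t x‖ * F x ∂μ ≤
      2 ^ (Finset.univ : Finset ι).card * ∫ x, √(∑ j, ‖U j x‖ ^ 2) * F x ∂μ := by
    rw [← integral_finsetSum _ fun t _ => hi2 t, ← integral_const_mul]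
    refine integral_mono (integrable_finsetSum _ fun t _ => hi2 t) (hi3.const_mul _) fun x => ?_
    have := sum_norm_signSum_le (fun j => U j x) Finset.univ
    simp only [u, signSum_apply]
    rw [← Finset.sum_mul, ← mul_assoc]
    exact mul_le_mul_of_nonneg_right this (hF0 x)
  -- All three terms are averaged at once, so that a single choice of signs serves them together;
  -- the coefficients combine as (1 - l + 3l²/2) + (1 - η)l = 1 - ηl + 3l²/2.
  have hsum : ∑ t ∈ (Finset.univ : Finset ι).powerset, G t ≤
      ∑ t ∈ (Finset.univ : Finset ι).powerset, B := by
    rw [Finset.sum_const, nsmul_eq_mul, hcard]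
    simp only [G, B]
    rw [Finset.sum_add_distrib, Finset.sum_add_distrib, ← Finset.mul_sum, ← Finset.mul_sum,
      ← Finset.mul_sum, h2]
    have h3' := mul_le_mul_of_nonneg_left h3 hD
    linarith
  obtain ⟨t, _, ht⟩ := Finset.exists_le_of_sum_le ⟨∅, Finset.empty_mem_powerset _⟩ hsum
  exact ⟨t, ht⟩

end SignSelection

/-! ### Separability, and families escaping to infinity -/

section Escape

variable {X H : Type*} [MeasurableSpace X] {μ : Measure X} [NormedAddCommGroup H]
  [InnerProductSpace ℂ H] [RKHS ℂ H X ℂ]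

/-- Truncating at 1 and passing to the equivalent finite measure give a way of detecting nonzero
functions that is continuous under pointwise convergence. It serves to count basis vectors. -/
lemma IsSubspaceL2.integral_min_pos [SigmaFinite μ] (hL2 : IsSubspaceL2 H μ) {f : H}
    (hf : f ≠ 0) : 0 < ∫ x, min 1 (‖f x‖ ^ 2) ∂μ.toFinite := by
  have hm : AEStronglyMeasurable (fun x => min 1 (‖f x‖ ^ 2)) μ.toFinite :=
    ((aestronglyMeasurable_const.inf (hL2.integrable_norm_sq f).1)).mono_ac
      (toFinite_absolutelyContinuous μ)
  have hnn : ∀ x, 0 ≤ min 1 (‖f x‖ ^ 2) := fun x => le_min zero_le_one (by positivity)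
  have hint : Integrable (fun x => min 1 (‖f x‖ ^ 2)) μ.toFinite :=
    Integrable.of_bound hm 1 (Filter.Eventually.of_forall fun x => by
      rw [Real.norm_of_nonneg (hnn x)]; exact min_le_left _ _)
  refine lt_of_le_of_ne (integral_nonneg hnn) fun h0 => hf ?_
  have h1 := (integral_eq_zero_iff_of_nonneg hnn hint).1 h0.symm
  have h2 : ∀ᵐ x ∂μ, min 1 (‖f x‖ ^ 2) = 0 := by
    rw [← ae_toFinite]; exact h1
  have h3 : ∫ x, ‖f x‖ ^ 2 ∂μ = 0 := by
    refine integral_eq_zero_of_ae ?_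
    filter_upwards [h2] with x hx
    rcases min_choice 1 (‖f x‖ ^ 2) with h | h
    · rw [h] at hx; exact absurd hx one_ne_zero
    · rw [h] at hx; exact hx
  rw [hL2.integral_norm_sq] at h3
  exact norm_eq_zero.1 (pow_eq_zero_iff two_ne_zero |>.1 h3)

variable [CompleteSpace H]

/-- A reproducing kernel Hilbert space contained in `L²` of a σ-finite measure is separable. -/
lemma IsSubspaceL2.separableSpace [SigmaFinite μ] (hL2 : IsSubspaceL2 H μ) :
    TopologicalSpace.SeparableSpace H := by
  obtain ⟨w, b, hb⟩ := exists_hilbertBasis ℂ H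
  let G : w → ℝ := fun i => ∫ x, min 1 (‖b i x‖ ^ 2) ∂μ.toFinite
  have hG : ∀ i, 0 < G i := fun i => hL2.integral_min_pos (b.orthonormal.ne_zero i)
  -- Along an infinite orthonormal sequence the values at each point tend to zero by Bessel's
  -- inequality, so dominated convergence drives `G` to zero.
  have hfin : ∀ m : ℕ, {i | 1 / ((m : ℝ) + 1) ≤ G i}.Finite := by
    intro m
    by_contra hinf
    have hinf : {i | 1 / ((m : ℝ) + 1) ≤ G i}.Infinite := hinf
    let i : ℕ ↪ {i | 1 / ((m : ℝ) + 1) ≤ G i} := hinf.natEmbedding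
    let v : ℕ → H := fun n => b (i n).1
    have hv : Orthonormal ℂ v :=
      b.orthonormal.comp (fun n => (i n).1) (Subtype.val_injective.comp i.injective)
    have hpt : ∀ x : X, Filter.Tendsto (fun n => ‖v n x‖ ^ 2) Filter.atTop (𝓝 0) := fun x => by
      have := (hv.inner_products_summable (x := evalVec H x)).tendsto_atTop_zero
      refine this.congr fun n => ?_
      rw [norm_inner_symm, inner_evalVec]
    have hlim : Filter.Tendsto (fun n => ∫ x, min 1 (‖v n x‖ ^ 2) ∂μ.toFinite) Filter.atTop
        (𝓝 (∫ _, (0 : ℝ) ∂μ.toFinite)) := by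
      refine tendsto_integral_of_dominated_convergence (fun _ => 1) (fun n => ?_)
        (integrable_const _) (fun n => Filter.Eventually.of_forall fun x => ?_)
        (Filter.Eventually.of_forall fun x => ?_)
      · exact ((aestronglyMeasurable_const.inf (hL2.integrable_norm_sq (v n)).1)).mono_ac
          (toFinite_absolutelyContinuous μ)
      · rw [Real.norm_of_nonneg (le_min zero_le_one (by positivity))]; exact min_le_left _ _
      · simpa using (tendsto_const_nhds (x := (1 : ℝ))).min (hpt x)
    rw [integral_zero] at hlim
    have hge : 1 / ((m : ℝ) + 1) ≤ 0 := ge_of_tendsto' hlim fun n => (i n).2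
    have : 0 < 1 / ((m : ℝ) + 1) := by positivity
    linarith
  have hcount : Countable w := by
    rw [← Set.countable_univ_iff]
    refine (Set.countable_iUnion fun m => (hfin m).countable).mono fun i _ => ?_
    obtain ⟨m, hm⟩ := exists_nat_one_div_lt (hG i)
    exact Set.mem_iUnion.2 ⟨m, hm.le⟩
  have hsep := ((Set.countable_range b).isSeparable.span (R := ℂ)).closure
  have htop : closure (Submodule.span ℂ (Set.range b) : Set H) = Set.univ := by
    rw [← Submodule.topologicalClosure_coe, b.dense_span]; rfl
  rw [htop] at hsep
  exact TopologicalSpace.isSeparable_univ_iff.1 hsep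

/-- A sequence of functions bounded in `L²` and tending to zero pointwise tends to zero weakly
after taking moduli. -/
lemma tendsto_integral_mul_zero {F : X → ℝ} (hF : MemLp F 2 μ) (hF0 : ∀ x, 0 ≤ F x)
    {g : ℕ → X → ℝ} (hg : ∀ n, MemLp (g n) 2 μ) (hg0 : ∀ n x, 0 ≤ g n x)
    (hg1 : ∀ n, ∫ x, g n x ^ 2 ∂μ ≤ 1)
    (hlim : ∀ x, Filter.Tendsto (fun n => g n x) Filter.atTop (𝓝 0)) :
    Filter.Tendsto (fun n => ∫ x, g n x * F x ∂μ) Filter.atTop (𝓝 0) := by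
  rw [Metric.tendsto_atTop]
  intro ε hε
  -- Where g exceeds cF one has gF ≤ g²/c, with integral at most 1/c = ε/2; the rest is dominated by
  -- cF².
  let c : ℝ := 2 / ε
  have hc : 0 < c := by positivity
  have hF2 : Integrable (fun x => F x ^ 2) μ := hF.integrable_sq
  have hmin : ∀ n, AEStronglyMeasurable (fun x => min (g n x) (c * F x) * F x) μ := fun n =>
    ((hg n).1.inf (hF.1.const_mul c)).mul hF.1
  have hbd : ∀ n x, ‖min (g n x) (c * F x) * F x‖ ≤ c * F x ^ 2 := fun n x => by
    have h0 : 0 ≤ min (g n x) (c * F x) := le_min (hg0 n x) (mul_nonneg hc.le (hF0 x))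
    rw [Real.norm_of_nonneg (mul_nonneg h0 (hF0 x)), sq, ← mul_assoc]
    exact mul_le_mul_of_nonneg_right (min_le_right _ _) (hF0 x)
  have h1 : Filter.Tendsto (fun n => ∫ x, min (g n x) (c * F x) * F x ∂μ) Filter.atTop
      (𝓝 (∫ _, (0 : ℝ) ∂μ)) := by
    refine tendsto_integral_of_dominated_convergence (fun x => c * F x ^ 2) hmin
      (hF2.const_mul c) (fun n => Filter.Eventually.of_forall (hbd n))
      (Filter.Eventually.of_forall fun x => ?_)
    have := ((hlim x).min (tendsto_const_nhds (x := c * F x))).mul_const (F x)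
    simpa [min_eq_left (mul_nonneg hc.le (hF0 x))] using this
  rw [integral_zero, Metric.tendsto_atTop] at h1
  obtain ⟨N, hN⟩ := h1 (ε / 2) (by positivity)
  refine ⟨N, fun n hn => ?_⟩
  have h2 := hN n hn
  rw [dist_zero_right, Real.norm_eq_abs, abs_lt] at h2 ⊢
  have hnn : 0 ≤ ∫ x, g n x * F x ∂μ := integral_nonneg fun x => mul_nonneg (hg0 n x) (hF0 x)
  refine ⟨by linarith, ?_⟩
  have hi1 : Integrable (fun x => min (g n x) (c * F x) * F x) μ :=
    (hF2.const_mul c).mono' (hmin n) (Filter.Eventually.of_forall (hbd n))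
  have hi2 : Integrable (fun x => g n x ^ 2 / c) μ := (hg n).integrable_sq.div_const c
  have hle : ∫ x, g n x * F x ∂μ ≤
      ∫ x, min (g n x) (c * F x) * F x ∂μ + ∫ x, g n x ^ 2 / c ∂μ := by
    rw [← integral_add hi1 hi2]
    refine integral_mono ((hg n).integrable_mul hF) (hi1.add hi2) fun x => ?_
    rcases le_total (g n x) (c * F x) with h | h
    · rw [min_eq_left h]
      have : 0 ≤ g n x ^ 2 / c := by positivity
      linarith
    · rw [min_eq_right h]
      have h3 : 0 ≤ c * F x * F x := mul_nonneg (mul_nonneg hc.le (hF0 x)) (hF0 x)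
      have h4 : g n x * F x ≤ g n x ^ 2 / c := by
        rw [le_div_iff₀ hc, sq]
        nlinarith [hg0 n x]
      linarith
  have h5 : ∫ x, g n x ^ 2 / c ∂μ ≤ ε / 2 := by
    rw [integral_div, div_le_iff₀ hc]
    have : ε / 2 * c = 1 := by simp only [c]; field_simp
    rw [this]; exact hg1 n
  linarith

/-- A family of total mass at most one that is nearly orthogonal to the first members of a dense
sequence is small against a given function in `L²`. -/
lemma IsSubspaceL2.exists_forall_integral_sqrt_le (hL2 : IsSubspaceL2 H μ) {e : ℕ → H}
    (he : DenseRange e) {F : X → ℝ} (hF : MemLp F 2 μ) (hF0 : ∀ x, 0 ≤ F x) {ε : ℝ}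
    (hε : 0 < ε) :
    ∃ n : ℕ, ∀ (ι : Type) [Fintype ι] (U : ι → H), ∑ j, ‖U j‖ ^ 2 ≤ 1 →
      (∀ i < n, ∑ j, ‖inner ℂ (e i) (U j)‖ ^ 2 ≤ 1 / ((n : ℝ) + 1)) →
      ∫ x, √(∑ j, ‖U j x‖ ^ 2) * F x ∂μ ≤ ε := by
  by_contra hcon
  push Not at hcon
  choose ι _ U hU1 hU2 hU3 using hcon
  -- Were the claim false, there would be a bad family for each n. Its square function tends to zero
  -- at every point, since the kernel vector there is close to some `e i`, and bounded L² norms then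
  -- contradict `tendsto_integral_mul_zero`.
  have hlim : ∀ x, Filter.Tendsto (fun n => √(∑ j, ‖U n j x‖ ^ 2)) Filter.atTop (𝓝 0) := by
    intro x
    rw [← Real.sqrt_zero]
    refine (Real.continuous_sqrt.tendsto 0).comp ?_
    rw [Metric.tendsto_atTop]
    intro δ hδ
    obtain ⟨i, hi⟩ := he.exists_dist_lt (evalVec H x) (ε := √(δ / 4)) (by positivity)
    obtain ⟨m, hm⟩ := exists_nat_one_div_lt (show 0 < δ / 4 by positivity)
    refine ⟨max m (i + 1), fun n hn => ?_⟩
    have hin : i < n := lt_of_lt_of_le (Nat.lt_succ_self i) ((le_max_right _ _).trans hn)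
    have hmn : m ≤ n := (le_max_left _ _).trans hn
    have hs : ∀ j, ‖U n j x‖ ^ 2 ≤ 2 * ‖inner ℂ (e i) (U n j)‖ ^ 2 + 2 * (δ / 4) * ‖U n j‖ ^ 2 := by
      intro j
      have h1 : U n j x = inner ℂ (e i) (U n j) + inner ℂ (evalVec H x - e i) (U n j) := by
        rw [← inner_add_left, ← inner_evalVec]; simp
      have h2 : ‖inner ℂ (evalVec H x - e i) (U n j)‖ ≤ √(δ / 4) * ‖U n j‖ := by
        refine (norm_inner_le_norm _ _).trans ?_
        rw [dist_eq_norm] at hi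
        gcongr
      have h3 : ‖U n j x‖ ≤ ‖inner ℂ (e i) (U n j)‖ + √(δ / 4) * ‖U n j‖ := by
        rw [h1]; exact (norm_add_le _ _).trans (by gcongr)
      have h4 : √(δ / 4) ^ 2 = δ / 4 := Real.sq_sqrt (by positivity)
      calc ‖U n j x‖ ^ 2 ≤ (‖inner ℂ (e i) (U n j)‖ + √(δ / 4) * ‖U n j‖) ^ 2 := by gcongr
        _ ≤ 2 * ‖inner ℂ (e i) (U n j)‖ ^ 2 + 2 * (√(δ / 4) * ‖U n j‖) ^ 2 := by
          nlinarith [sq_nonneg (‖inner ℂ (e i) (U n j)‖ - √(δ / 4) * ‖U n j‖)]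
        _ = _ := by rw [mul_pow, h4]; ring
    have hnn : 0 ≤ ∑ j, ‖U n j x‖ ^ 2 := Finset.sum_nonneg fun _ _ => by positivity
    rw [dist_zero_right, Real.norm_of_nonneg hnn]
    have hsum := Finset.sum_le_sum fun j (_ : j ∈ Finset.univ) => hs j
    rw [Finset.sum_add_distrib, ← Finset.mul_sum, ← Finset.mul_sum] at hsum
    have h5 := hU2 n i hin
    have h6 : 1 / ((n : ℝ) + 1) ≤ 1 / ((m : ℝ) + 1) := by gcongr
    have h7 : 2 * (δ / 4) * ∑ j, ‖U n j‖ ^ 2 ≤ 2 * (δ / 4) * 1 := by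
      gcongr; exact hU1 n
    linarith
  have := tendsto_integral_mul_zero hF hF0 (fun n => hL2.memLp_sqrt_sum_norm_sq (U n))
    (fun n x => Real.sqrt_nonneg _) (fun n => ?_) hlim
  · have h0 : ε ≤ 0 := ge_of_tendsto' this fun n => (hU3 n).le
    linarith
  · have : ∀ x, √(∑ j, ‖U n j x‖ ^ 2) ^ 2 = ∑ j, ‖U n j x‖ ^ 2 := fun x =>
      Real.sq_sqrt (Finset.sum_nonneg fun _ _ => by positivity)
    simp_rw [this]
    rw [hL2.integral_sum_norm_sq]
    exact hU1 n

end Escape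

/-! ### Nearly norming vectors that escape -/

section EscapingVectors

variable {X H : Type*} [MeasurableSpace X] {μ : Measure X} [NormedAddCommGroup H]
  [InnerProductSpace ℂ H] [CompleteSpace H] [RKHS ℂ H X ℂ] {A : Subalgebra ℂ (H →L[ℂ] H)}

/-- Powers keep norm one: where |ψ| > 1 - t, Bernoulli's inequality gives |ψ|^N ≥ 1 - Nt. -/
lemma IsMulOp.exists_lt_norm_pow_apply (hL2 : IsSubspaceL2 H μ)
    (hH : ∀ x : X, ∃ f : H, f x ≠ 0) {S : H →L[ℂ] H} {ψ : X → ℂ} (hS : IsMulOp S ψ)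
    (hS1 : ‖S‖ = 1) (N : ℕ) {ε : ℝ} (hε : 0 < ε) : ∃ w : H, ‖w‖ < 1 ∧ 1 - ε < ‖(S ^ N) w‖ := by
  apply ContinuousLinearMap.exists_lt_apply_of_lt_opNorm
  let t : ℝ := min 1 (ε / (N + 1))
  have ht0 : 0 < t := lt_min one_pos (by positivity)
  have ht1 : t ≤ 1 := min_le_left _ _
  have htN : N * t < ε := by
    have h1 : t ≤ ε / (N + 1) := min_le_right _ _
    have h2 : (N + 1 : ℝ) * t ≤ ε := by
      rw [le_div_iff₀ (by positivity)] at h1; linarith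
    linarith
  obtain ⟨y, hy⟩ : ∃ y, 1 - t < ‖ψ y‖ := by
    by_contra hcon
    push Not at hcon
    have := hS.opNorm_le hL2 (by linarith) hcon
    linarith
  have h3 := (hS.pow N).norm_apply_le_opNorm (hH y)
  rw [norm_pow] at h3
  have h4 : (1 - t) ^ N ≤ ‖ψ y‖ ^ N := pow_le_pow_left₀ (by linarith) hy.le N
  have h5 := one_add_mul_le_pow (show (-2 : ℝ) ≤ -t by linarith) N
  have h6 : (1 + -t) ^ N = (1 - t) ^ N := by ring
  linarith

/-- A multiplication operator of norm one by a function of modulus less than one almost attains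
its norm at vectors that are nearly orthogonal to given ones. -/
lemma IsMulOp.exists_escaping (hL2 : IsSubspaceL2 H μ)
    (hH : ∀ x : X, ∃ f : H, f x ≠ 0) {S P : H →L[ℂ] H} {ψ : X → ℂ} (hS : IsMulOp S ψ)
    (hS1 : ‖S‖ = 1) (hψ : ∀ x, ‖ψ x‖ < 1) (hPS : P * S = S) (e : ℕ → H) (n : ℕ) {δ ε : ℝ}
    (hδ : 0 < δ) (hε : 0 < ε) :
    ∃ u : H, P u = u ∧ ‖u‖ ≤ 1 ∧ (∀ i < n, ‖inner ℂ (e i) u‖ ≤ δ) ∧ 1 - ε ≤ ‖S u‖ := by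
  choose w hw1 hw2 using fun N => hS.exists_lt_norm_pow_apply hL2 hH hS1 (N + 2) hε
  -- Since |ψ| < 1 these vectors tend to zero pointwise, hence weakly, while one more application of
  -- `S` still has norm near one. The positive exponent ensures `P u = u`.
  let u : ℕ → H := fun N => (S ^ (N + 1)) (w N)
  have hu1 : ∀ N, ‖u N‖ ≤ 1 := fun N => by
    refine ((S ^ (N + 1)).le_opNorm _).trans ?_
    have : ‖S ^ (N + 1)‖ ≤ 1 := (norm_pow_le' S N.succ_pos).trans (by rw [hS1, one_pow])
    exact mul_le_one₀ this (norm_nonneg _) (hw1 N).le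
  have hpt : ∀ x : X, Filter.Tendsto (fun N => u N x) Filter.atTop (𝓝 0) := fun x => by
    have h1 : Filter.Tendsto (fun N => ‖ψ x‖ ^ (N + 1) * ‖evalVec H x‖) Filter.atTop (𝓝 0) := by
      have := ((tendsto_pow_atTop_nhds_zero_of_lt_one (norm_nonneg _) (hψ x)).comp
        (Filter.tendsto_add_atTop_nat 1)).mul_const ‖evalVec H x‖
      simpa using this
    refine squeeze_zero_norm (fun N => ?_) h1
    rw [hS.pow (N + 1), norm_mul, norm_pow]
    gcongr
    refine (norm_apply_le_evalVec x (w N)).trans ?_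
    exact mul_le_of_le_one_right (norm_nonneg _) (hw1 N).le
  have hev : ∀ᶠ N in Filter.atTop, ∀ i ∈ Finset.range n, ‖inner ℂ (e i) (u N)‖ ≤ δ := by
    rw [Filter.eventually_all_finset]
    intro i _
    have := tendsto_inner_zero_of_pointwise hu1 hpt (e i)
    filter_upwards [Metric.tendsto_nhds.1 this δ hδ] with N hN
    rw [dist_zero_right] at hN
    exact hN.le
  obtain ⟨N, hN⟩ := hev.exists
  refine ⟨u N, ?_, hu1 N, fun i hi => hN i (Finset.mem_range.2 hi), ?_⟩
  · change (P * S ^ (N + 1)) (w N) = _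
    rw [pow_succ', ← mul_assoc, hPS, ← pow_succ']
  · have h : S (u N) = (S ^ (N + 2)) (w N) := by
      rw [pow_succ' S (N + 1)]; rfl
    rw [h]; exact (hw2 N).le

variable {x₀ : X} {P : H →L[ℂ] H}

/-- On a component on which `A` is not constant, the norms of the operators in `A` are attained
approximately at vectors that are nearly orthogonal to given ones. -/
lemma exists_escaping_pair (hL2 : IsSubspaceL2 H μ) (hH : ∀ x : X, ∃ f : H, f x ≠ 0)
    (hA : IsDualAlgebraOfMultipliers A)
    (hP : IsMulOp P ((component A x₀).indicator fun _ => (1 : ℂ)))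
    (hnc : ∃ θ ∈ symbols A, ∃ y ∈ component A x₀, ∃ z ∈ component A x₀, θ y ≠ θ z)
    {T : H →L[ℂ] H} (hT : T ∈ A) (e : ℕ → H) (n : ℕ) {δ ε : ℝ} (hδ : 0 < δ) (hε : 0 < ε) :
    ∃ u v : H, P u = u ∧ P v = v ∧ ‖u‖ ≤ 1 ∧ ‖v‖ ≤ 1 ∧ (∀ i < n, ‖inner ℂ (e i) u‖ ≤ δ) ∧
      ‖P * T‖ - ε ≤ (inner ℂ v (T u)).re := by
  obtain ⟨ψ, hψ⟩ := hA.subset_multipliers hT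
  have hPP : P * P = P := (hP.mul hP).eq_of_eq hP (by
    funext x; by_cases hx : x ∈ component A x₀ <;> simp [hx])
  have hPT : P * T = T * P := (hP.mul hψ).eq_of_eq (hψ.mul hP) (by funext x; ring)
  rcases (norm_nonneg (P * T)).eq_or_lt with h0 | hm
  · exact ⟨0, 0, by simp, by simp, by simp, by simp, by simp [hδ.le], by
      rw [← h0]; simpa using hε.le⟩
  -- normalization of a multiplier on the component
  have key : ∀ (T' : H →L[ℂ] H) (ψ' : X → ℂ), T' ∈ A → IsMulOp T' ψ' → 0 < ‖P * T'‖ →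
      (∀ y ∈ component A x₀, ‖((‖P * T'‖ : ℂ))⁻¹ * ψ' y‖ < 1) → ∀ ε' : ℝ, 0 < ε' →
      ∃ u : H, P u = u ∧ ‖u‖ ≤ 1 ∧ (∀ i < n, ‖inner ℂ (e i) u‖ ≤ δ) ∧
        1 - ε' ≤ ‖(((‖P * T'‖ : ℂ))⁻¹ • (P * T')) u‖ := by
    intro T' ψ' _ hψ' hpos hlt ε' hε'
    refine ((hP.mul hψ').smul _).exists_escaping hL2 hH ?_ (fun x => ?_) ?_ e n hδ hε'
    · rw [norm_smul, norm_inv, Complex.norm_real, norm_norm, inv_mul_cancel₀ hpos.ne']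
    · by_cases hx : x ∈ component A x₀
      · simpa [hx] using hlt x hx
      · simp [hx]
    · rw [mul_smul_comm, ← mul_assoc, hPP]
  have hbd : ∀ (T' : H →L[ℂ] H) (ψ' : X → ℂ), IsMulOp T' ψ' → 0 < ‖P * T'‖ →
      ∀ y ∈ component A x₀, ‖((‖P * T'‖ : ℂ))⁻¹ * ψ' y‖ ≤ 1 := by
    intro T' ψ' hψ' hpos y hy
    have := (hP.mul hψ').norm_apply_le_opNorm (hH y)
    rw [Set.indicator_of_mem hy, one_mul] at this
    rw [norm_mul, norm_inv, Complex.norm_real, norm_norm, inv_mul_le_iff₀ hpos, mul_one]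
    exact this
  set m := ‖P * T‖ with hmdef
  let S : H →L[ℂ] H := ((m : ℂ))⁻¹ • (P * T)
  have hSm : ‖S‖ ≤ 1 := by
    rw [norm_smul, norm_inv, Complex.norm_real, norm_norm, ← hmdef, inv_mul_cancel₀ hm.ne']
  have hmC : (m : ℂ) ≠ 0 := by exact_mod_cast hm.ne'
  -- With v = Su the inner product is m‖Su‖² ≥ m(1 - ε')² ≥ m - 2mε' ≥ m - ε.
  let ε' : ℝ := min 1 (ε / (2 * m))
  have hε'0 : 0 < ε' := lt_min one_pos (by positivity)
  suffices hu : ∃ u : H, P u = u ∧ ‖u‖ ≤ 1 ∧ (∀ i < n, ‖inner ℂ (e i) u‖ ≤ δ) ∧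
      1 - ε' ≤ ‖S u‖ by
    obtain ⟨u, hPu, hu1, hue, hSu⟩ := hu
    have hTu : T u = (m : ℂ) • S u := by
      simp only [S, smul_apply]
      rw [smul_smul, mul_inv_cancel₀ hmC, one_smul, hPT]
      change T u = T (P u)
      rw [hPu]
    refine ⟨u, S u, hPu, ?_, hu1, (S.le_of_opNorm_le hSm u).trans (by simpa using hu1), hue, ?_⟩
    · change (P * S) u = S u
      simp only [S]
      rw [mul_smul_comm, ← mul_assoc, hPP]
    · rw [hTu, inner_smul_right, inner_self_eq_norm_sq_to_K]
      have h1 : (((m : ℂ)) * ((‖S u‖ : ℂ)) ^ 2).re = m * ‖S u‖ ^ 2 := by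
        rw [← Complex.ofReal_pow, ← Complex.ofReal_mul, Complex.ofReal_re]
      have h2 : ((m : ℂ) * ((‖S u‖ : ℝ) : ℂ) ^ 2).re = m * ‖S u‖ ^ 2 := h1
      have h3 : ε' ≤ 1 := min_le_left _ _
      have h4 : m * ε' ≤ ε / 2 := by
        have : ε' ≤ ε / (2 * m) := min_le_right _ _
        rw [le_div_iff₀ (by positivity)] at this
        linarith
      have h5 : (1 - ε') ^ 2 ≤ ‖S u‖ ^ 2 := pow_le_pow_left₀ (by linarith) hSu 2
      have h6 : m * (1 - ε') ^ 2 ≤ m * ‖S u‖ ^ 2 := by gcongr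
      refine le_trans ?_ (le_of_eq h2.symm)
      nlinarith [mul_nonneg hm.le (sq_nonneg ε')]
  by_cases hcase : ∀ y ∈ component A x₀, ‖((m : ℂ))⁻¹ * ψ y‖ < 1
  · exact key T ψ hT hψ hm hcase ε' hε'0
  · push Not at hcase
    obtain ⟨y, hy, hy1⟩ := hcase
    -- If the modulus one is attained, the maximum principle makes `S` a unimodular scalar on the
    -- range of `P`, so any escaping vector of norm near one will do. The nonconstant θ supplies
    -- one: by the same principle its normalization has modulus less than one on the component.
    have hbd' := hbd T ψ hψ hm
    have hconst := eq_of_norm_eq_one_of_mem_component hL2 hH hA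
      (smul_mem_symbols ((m : ℂ))⁻¹ ⟨T, hT, hψ⟩) hbd' hy (le_antisymm (hbd' y hy) hy1)
    obtain ⟨θ, ⟨Tθ, hTθ, hθ⟩, y₁, hy₁, y₂, hy₂, hne⟩ := hnc
    have hpos : 0 < ‖P * Tθ‖ := by
      rw [norm_pos_iff]
      intro h0
      have hz : ∀ y ∈ component A x₀, θ y = 0 := fun y hy => by
        have := (hP.mul hθ).norm_apply_le_opNorm (hH y)
        rw [h0, norm_zero, Set.indicator_of_mem hy, one_mul] at this
        exact norm_le_zero_iff.1 this
      exact hne ((hz y₁ hy₁).trans (hz y₂ hy₂).symm)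
    obtain ⟨u, hPu, hu1, hue, hu2⟩ := key Tθ θ hTθ hθ hpos (fun z hz => by
      refine lt_of_le_of_ne (hbd Tθ θ hθ hpos z hz) fun h1 => hne ?_
      have hc := eq_of_norm_eq_one_of_mem_component hL2 hH hA
        (smul_mem_symbols ((‖P * Tθ‖ : ℂ))⁻¹ ⟨Tθ, hTθ, hθ⟩) (hbd Tθ θ hθ hpos) hz h1
      have h2 := (hc y₁ hy₁).trans (hc y₂ hy₂).symm
      refine mul_left_cancel₀ (inv_ne_zero ?_) h2
      exact_mod_cast hpos.ne') ε' hε'0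
    refine ⟨u, hPu, hu1, hue, ?_⟩
    have hSu : S u = (((m : ℂ))⁻¹ * ψ y) • u := RKHS.ext fun z => by
      rw [((hP.mul hψ).smul _) u z, RKHS.coe_smul, Pi.smul_apply, smul_eq_mul]
      beta_reduce
      by_cases hz : z ∈ component A x₀
      · rw [Set.indicator_of_mem hz, one_mul, hconst z hz]
      · have : u z = 0 := by rw [← hPu, hP]; simp [hz]
        rw [this]; simp
    rw [hSu, norm_smul, le_antisymm (hbd' y hy) hy1, one_mul]
    refine hu2.trans ?_
    refine (ContinuousLinearMap.le_opNorm _ _).trans ?_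
    rw [norm_smul, norm_inv, Complex.norm_real, norm_norm, inv_mul_cancel₀ hpos.ne', one_mul]

/-- A functional in the predual of norm at most one that is carried by a component on which `A`
is not constant is approximated by convex combinations of vector functionals with vectors that
are nearly orthogonal to given ones. -/
lemma mem_closure_convexHull_escaping (hL2 : IsSubspaceL2 H μ)
    (hH : ∀ x : X, ∃ f : H, f x ≠ 0) (hA : IsDualAlgebraOfMultipliers A) (hPA : P ∈ A)
    (hP : IsMulOp P ((component A x₀).indicator fun _ => (1 : ℂ)))
    (hnc : ∃ θ ∈ symbols A, ∃ y ∈ component A x₀, ∃ z ∈ component A x₀, θ y ≠ θ z)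
    {R : StrongDual ℂ (OpSpace A)} (hR : R ∈ predual A) (hR1 : ‖R‖ ≤ 1)
    (hRP : ∀ T : OpSpace A, R (OpSpace.of (P * OpSpace.op T) (A.mul_mem hPA T.op_mem)) = R T)
    (e : ℕ → H) (n : ℕ) {δ : ℝ} (hδ : 0 < δ) :
    R ∈ closure (convexHull ℝ {Q | ∃ u v : H, P u = u ∧ P v = v ∧ ‖u‖ ≤ 1 ∧ ‖v‖ ≤ 1 ∧
      (∀ i < n, ‖inner ℂ (e i) u‖ ≤ δ) ∧ vectorFunctional A u v = Q}) := by
  by_contra hcon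
  -- A separating functional acts on the predual as some `T` in A. Then Re R(PT) exceeds s and is at
  -- most ‖PT‖, but escaping pairs come arbitrarily close to ‖PT‖.
  obtain ⟨ξ, s, hs, hsR⟩ := RCLike.geometric_hahn_banach_closed_point (𝕜 := ℂ)
    (convex_convexHull ℝ _).closure isClosed_closure hcon
  obtain ⟨T, hT⟩ := exists_mem_eq_apply hA.isDualAlgebra ξ
  rw [hT R hR, ← hRP T] at hsR
  have h1 : s < ‖P * OpSpace.op T‖ := by
    refine hsR.trans_le ((RCLike.re_le_norm _).trans ((R.le_opNorm _).trans ?_))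
    rw [← OpSpace.op.norm_map, OpSpace.op_of]
    exact mul_le_of_le_one_left (norm_nonneg _) hR1
  obtain ⟨u, v, hu, hv, hu1, hv1, hue, huv⟩ := exists_escaping_pair hL2 hH hA hP hnc T.op_mem
    e n hδ (sub_pos.2 h1)
  have h2 := hs (vectorFunctional A u v)
    (subset_closure (subset_convexHull ℝ _ ⟨u, v, hu, hv, hu1, hv1, hue, rfl⟩))
  rw [hT _ (vectorFunctional_mem_predual A u v), vectorFunctional_apply] at h2
  have h3 : RCLike.re (inner ℂ v (OpSpace.op T u)) = (inner ℂ v (OpSpace.op T u)).re := rfl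
  linarith

end EscapingVectors

/-! ### Operators that nearly norm a functional -/

section NearNorming

lemma exists_near_norming {E : Type*} [NormedAddCommGroup E] [NormedSpace ℂ E]
    {R : StrongDual ℂ E} (hR : ‖R‖ = 1) {ε : ℝ} (hε : 0 < ε) :
    ∃ T : E, ‖T‖ ≤ 1 ∧ 1 - ε ≤ (R T).re := by
  obtain ⟨T, hT1, hT2⟩ := R.exists_lt_apply_of_lt_opNorm (r := 1 - ε) (by linarith)
  by_cases h0 : R T = 0
  · refine ⟨0, by simp, ?_⟩
    rw [h0, norm_zero] at hT2
    simpa using hT2.le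
  · have hn : ((‖R T‖ : ℝ) : ℂ) ≠ 0 := by exact_mod_cast norm_ne_zero_iff.2 h0
    refine ⟨(conj (R T) / (‖R T‖ : ℂ)) • T, ?_, ?_⟩
    · rw [norm_smul, norm_div, RCLike.norm_conj, Complex.norm_real, norm_norm,
        div_self (norm_ne_zero_iff.2 h0), one_mul]
      exact hT1.le
    · have : R ((conj (R T) / (‖R T‖ : ℂ)) • T) = ((‖R T‖ : ℝ) : ℂ) := by
        rw [map_smul, smul_eq_mul, div_mul_eq_mul_div, mul_comm, Complex.mul_conj,
          Complex.normSq_eq_norm_sq, div_eq_iff hn]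
        push_cast; ring
      rw [this, Complex.ofReal_re]; exact hT2.le

/-- Near equality in Cauchy–Schwarz: as `Φ` almost norms the sum, ∑ ‖V_j - ΦU_j‖² ≤ 2 - 2(1 - ε²/2)
= ε². The second vectors may thus be taken to be multiples of the first by one bounded function. -/
lemma vectorFunctional_sum_close {H : Type*} [NormedAddCommGroup H] [InnerProductSpace ℂ H]
    {ι : Type*} [Fintype ι] (A : Subalgebra ℂ (H →L[ℂ] H))
    (U V : ι → H) {Φ : OpSpace A} (hΦ1 : ‖Φ‖ ≤ 1) {ε : ℝ}
    (hU : ∑ j, ‖U j‖ ^ 2 ≤ 1) (hV : ∑ j, ‖V j‖ ^ 2 ≤ 1)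
    (h : 1 - ε ^ 2 / 2 ≤ ((∑ j, vectorFunctional A (U j) (V j)) Φ).re) (hε : 0 ≤ ε) :
    ‖∑ j, vectorFunctional A (U j) (V j) -
      ∑ j, vectorFunctional A (U j) (OpSpace.op Φ (U j))‖ ≤ ε := by
  have hre : ((∑ j, vectorFunctional A (U j) (V j)) Φ).re =
      ∑ j, (inner ℂ (V j) (OpSpace.op Φ (U j))).re := by
    simp
  have hΦU : ∀ j, ‖OpSpace.op Φ (U j)‖ ^ 2 ≤ ‖U j‖ ^ 2 := fun j => by
    have h1 : ‖OpSpace.op Φ‖ ≤ 1 := by rw [OpSpace.op.norm_map]; exact hΦ1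
    have := (OpSpace.op Φ).le_of_opNorm_le h1 (U j)
    rw [one_mul] at this
    gcongr
  have hd : ∑ j, ‖V j - OpSpace.op Φ (U j)‖ ^ 2 ≤ ε ^ 2 := by
    have h2 : ∀ j, ‖V j - OpSpace.op Φ (U j)‖ ^ 2 ≤
        ‖V j‖ ^ 2 - 2 * (inner ℂ (V j) (OpSpace.op Φ (U j))).re + ‖U j‖ ^ 2 := fun j => by
      have h3 := norm_sub_sq (𝕜 := ℂ) (V j) (OpSpace.op Φ (U j))
      have h4 : RCLike.re (inner ℂ (V j) (OpSpace.op Φ (U j))) =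
        (inner ℂ (V j) (OpSpace.op Φ (U j))).re := rfl
      rw [h4] at h3
      linarith [hΦU j]
    refine (Finset.sum_le_sum fun j _ => h2 j).trans ?_
    rw [Finset.sum_add_distrib, Finset.sum_sub_distrib, ← Finset.mul_sum, ← hre]
    linarith
  rw [← Finset.sum_sub_distrib]
  refine (norm_sum_le _ _).trans ?_
  have h5 : ∀ j, ‖vectorFunctional A (U j) (V j) -
      vectorFunctional A (U j) (OpSpace.op Φ (U j))‖ ≤ ‖U j‖ * ‖V j - OpSpace.op Φ (U j)‖ :=
    fun j => by
      rw [← vectorFunctional_sub_right]; exact norm_vectorFunctional_le A _ _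
  refine (Finset.sum_le_sum fun j _ => h5 j).trans ?_
  refine le_of_sq_le_sq ?_ hε
  refine (Finset.sum_mul_sq_le_sq_mul_sq _ _ _).trans ?_
  calc (∑ j, ‖U j‖ ^ 2) * ∑ j, ‖V j - OpSpace.op Φ (U j)‖ ^ 2 ≤ 1 * ε ^ 2 := by
        gcongr
    _ = ε ^ 2 := one_mul _

end NearNorming

/-! ### Reducing the norm by one vector functional -/

section Reduction

variable {X H : Type*} [MeasurableSpace X] {μ : Measure X} [NormedAddCommGroup H]
  [InnerProductSpace ℂ H] [CompleteSpace H] [RKHS ℂ H X ℂ] {A : Subalgebra ℂ (H →L[ℂ] H)}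

/-- The functional of a pair (v, Φv) integrates ψ against conj φ |v|². A sum of such functionals
depends only on the total density, so many vectors can be compared with one through an L¹ distance.
-/
lemma norm_sum_vectorFunctional_sub_le (hL2 : IsSubspaceL2 H μ)
    (hH : ∀ x : X, ∃ f : H, f x ≠ 0) (hA : IsDualAlgebraOfMultipliers A) {Φ : H →L[ℂ] H}
    {φ : X → ℂ} (hΦ : IsMulOp Φ φ) (hφ : ∀ x, ‖φ x‖ ≤ 1) {ι : Type*} [Fintype ι] (U : ι → H)
    (u : H) (l : ℝ) :
    ‖∑ j, vectorFunctional A (U j) (Φ (U j)) - (l : ℂ) • vectorFunctional A u (Φ u)‖ ≤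
      ∫ x, |∑ j, ‖U j x‖ ^ 2 - l * ‖u x‖ ^ 2| ∂μ := by
  refine ContinuousLinearMap.opNorm_le_bound _ (integral_nonneg fun x => abs_nonneg _) fun T => ?_
  obtain ⟨ψ, hψ⟩ := hA.subset_multipliers T.op_mem
  have hval : (∑ j, vectorFunctional A (U j) (Φ (U j)) -
      (l : ℂ) • vectorFunctional A u (Φ u)) T =
      ∫ x, conj (φ x) * ψ x * ((∑ j, ‖U j x‖ ^ 2 - l * ‖u x‖ ^ 2 : ℝ) : ℂ) ∂μ := by
    have h1 : (∑ j, vectorFunctional A (U j) (Φ (U j)) -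
        (l : ℂ) • vectorFunctional A u (Φ u)) T =
        ∑ j, inner ℂ (Φ (U j)) (OpSpace.op T (U j)) - l * inner ℂ (Φ u) (OpSpace.op T u) := by
      simp
    rw [h1]
    simp_rw [hL2.inner_eq_integral]
    rw [← integral_finsetSum _ fun j _ => hL2.integrable_mul _ _, ← integral_const_mul,
      ← integral_sub (integrable_finsetSum _ fun j _ => hL2.integrable_mul _ _)
        ((hL2.integrable_mul _ _).const_mul _)]
    refine integral_congr_ae (Filter.Eventually.of_forall fun x => ?_)
    have h2 : ∀ v : H, conj (Φ v x) * OpSpace.op T v x =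
        conj (φ x) * ψ x * ((‖v x‖ ^ 2 : ℝ) : ℂ) := fun v => by
      rw [hΦ, hψ, map_mul, ← Complex.normSq_eq_norm_sq, ← Complex.mul_conj]
      ring
    simp only [h2]
    rw [← Finset.mul_sum]
    push_cast
    ring
  rw [hval, ← integral_mul_const]
  refine norm_integral_le_of_norm_le ?_ (Filter.Eventually.of_forall fun x => ?_)
  · exact ((hL2.integrable_sum_norm_sq U).sub
      ((hL2.integrable_norm_sq u).const_mul l)).abs.mul_const _
  · rw [norm_mul, norm_mul, RCLike.norm_conj, Complex.norm_real, Real.norm_eq_abs,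
      mul_comm _ ‖T‖]
    refine mul_le_mul_of_nonneg_right ?_ (abs_nonneg _)
    have h3 : ‖ψ x‖ ≤ ‖T‖ := by
      rw [← OpSpace.op.norm_map]; exact hψ.norm_apply_le_opNorm (hH x)
    calc ‖φ x‖ * ‖ψ x‖ ≤ 1 * ‖T‖ := by gcongr; exact hφ x
      _ = ‖T‖ := one_mul _

variable {x₀ : X} {P : H →L[ℂ] H}

/-- The correction is `a = √l w`, `b = Φ a` with w a signed sum of escaping vectors. The weight 1 -
η on ‖a‖² expresses that hardly more squared norm is spent than norm of R is removed. -/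
lemma exists_reduction_of_norm_eq_one [SigmaFinite μ] (hL2 : IsSubspaceL2 H μ)
    (hH : ∀ x : X, ∃ f : H, f x ≠ 0) (hA : IsDualAlgebraOfMultipliers A) (hPA : P ∈ A)
    (hP : IsMulOp P ((component A x₀).indicator fun _ => (1 : ℂ)))
    (hnc : ∃ θ ∈ symbols A, ∃ y ∈ component A x₀, ∃ z ∈ component A x₀, θ y ≠ θ z)
    {R : StrongDual ℂ (OpSpace A)} (hR : R ∈ predual A) (hR1 : ‖R‖ = 1)
    (hRP : ∀ T : OpSpace A, R (OpSpace.of (P * OpSpace.op T) (A.mul_mem hPA T.op_mem)) = R T)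
    {F : X → ℝ} (hF : MemLp F 2 μ) (hF0 : ∀ x, 0 ≤ F x) {η τ : ℝ} (hη0 : 0 < η) (hη1 : η ≤ 1)
    (hτ : 0 < τ) :
    ∃ a b : H, P a = a ∧ P b = b ∧ (∀ x, ‖b x‖ ≤ ‖a x‖) ∧
      ‖R - vectorFunctional A a b‖ + (1 - η) * ‖a‖ ^ 2 ≤ 1 - η ^ 2 / 12 ∧
      ∫ x, ‖a x‖ * F x ∂μ ≤ τ := by
  classical
  have := hL2.separableSpace
  let e : ℕ → H := TopologicalSpace.denseSeq H
  have he : DenseRange e := TopologicalSpace.denseRange_denseSeq H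
  -- The unit of error: in all at most s² + 3s ≤ 4s = η²/24 is lost from the gain η²/6.
  let s : ℝ := η ^ 2 / 96
  have hs0 : 0 < s := by positivity
  have hs1 : s ≤ 1 / 96 := by
    have : η ^ 2 ≤ 1 := pow_le_one₀ hη0.le hη1
    simp only [s]; linarith
  -- The minimizer of -ηl + 3l²/2, with minimum -η²/6.
  let l : ℝ := η / 3
  have hl0 : 0 < l := by positivity
  -- The penalized term is at most 2 for the chosen signs, which is the wanted bound τ on the
  -- integral of |w|F.
  let D : ℝ := 2 / τ
  have hD : 0 < D := by positivity
  obtain ⟨Φ, hΦ1, hΦR⟩ := exists_near_norming hR1 (show 0 < s ^ 2 by positivity)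
  obtain ⟨φ, hφ⟩ := hA.subset_multipliers Φ.op_mem
  have hφ1 : ∀ x, ‖φ x‖ ≤ 1 := fun x => by
    refine (hφ.norm_apply_le_opNorm (hH x)).trans ?_
    rw [OpSpace.op.norm_map]; exact hΦ1
  obtain ⟨n, hn⟩ := hL2.exists_forall_integral_sqrt_le he hF hF0
    (show 0 < s * τ / 2 by positivity)
  let δ : ℝ := 1 / ((n : ℝ) + 1)
  have hδ0 : 0 < δ := by positivity
  have hδ1 : δ ≤ 1 := by
    rw [div_le_one (by positivity)]; linarith [(Nat.cast_nonneg n : (0 : ℝ) ≤ n)]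
  have hcl := mem_closure_convexHull_escaping hL2 hH hA hPA hP hnc hR hR1.le hRP e n hδ0
  obtain ⟨Q, hQ, hRQ⟩ := Metric.mem_closure_iff.1 hcl (s ^ 2) (by positivity)
  rw [dist_eq_norm] at hRQ
  obtain ⟨ι, _, t, q, ht0, ht1, hq, hQq⟩ := mem_convexHull_iff_exists_fintype.1 hQ
  choose u v hPu hPv hu1 hv1 hue huv using hq
  -- The convex weights are split evenly between the two vectors, so both families have total
  -- squared norm at most one.
  let U : ι → H := fun j => ((√(t j) : ℝ) : ℂ) • u j
  let V : ι → H := fun j => ((√(t j) : ℝ) : ℂ) • v j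
  have hsq : ∀ j, √(t j) ^ 2 = t j := fun j => Real.sq_sqrt (ht0 j)
  have hnormU : ∀ j, ‖U j‖ ^ 2 = t j * ‖u j‖ ^ 2 := fun j => by
    simp only [U]
    rw [norm_smul, mul_pow, Complex.norm_real, Real.norm_eq_abs, sq_abs, hsq]
  have hnormV : ∀ j, ‖V j‖ ^ 2 = t j * ‖v j‖ ^ 2 := fun j => by
    simp only [V]
    rw [norm_smul, mul_pow, Complex.norm_real, Real.norm_eq_abs, sq_abs, hsq]
  have hUsum : ∑ j, ‖U j‖ ^ 2 ≤ 1 := by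
    rw [← ht1]
    refine Finset.sum_le_sum fun j _ => ?_
    rw [hnormU]
    exact mul_le_of_le_one_right (ht0 j) (pow_le_one₀ (norm_nonneg _) (hu1 j))
  have hVsum : ∑ j, ‖V j‖ ^ 2 ≤ 1 := by
    rw [← ht1]
    refine Finset.sum_le_sum fun j _ => ?_
    rw [hnormV]
    exact mul_le_of_le_one_right (ht0 j) (pow_le_one₀ (norm_nonneg _) (hv1 j))
  have hUe : ∀ i < n, ∑ j, ‖inner ℂ (e i) (U j)‖ ^ 2 ≤ 1 / ((n : ℝ) + 1) := by
    intro i hi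
    have h1 : ∀ j, ‖inner ℂ (e i) (U j)‖ ^ 2 ≤ t j * δ := fun j => by
      simp only [U]
      rw [inner_smul_right, norm_mul, mul_pow, Complex.norm_real, Real.norm_eq_abs, sq_abs, hsq]
      refine mul_le_mul_of_nonneg_left ?_ (ht0 j)
      calc ‖inner ℂ (e i) (u j)‖ ^ 2 ≤ δ ^ 2 := by gcongr; exact hue j i hi
        _ ≤ δ := by nlinarith
    refine (Finset.sum_le_sum fun j _ => h1 j).trans ?_
    rw [← Finset.sum_mul, ht1, one_mul]
  have hQUV : Q = ∑ j, vectorFunctional A (U j) (V j) := by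
    rw [← hQq]
    refine Finset.sum_congr rfl fun j _ => ?_
    simp only [U, V]
    rw [vectorFunctional_smul_left, vectorFunctional_smul_right, smul_smul, Complex.conj_ofReal,
      ← Complex.ofReal_mul, ← sq, hsq, huv]
    exact (Complex.coe_smul _ _).symm
  have hQΦ : 1 - (2 * s) ^ 2 / 2 ≤ (Q Φ).re := by
    have h1 : ‖(R - Q) Φ‖ ≤ s ^ 2 := by
      refine ((R - Q).le_opNorm Φ).trans ?_
      calc ‖R - Q‖ * ‖Φ‖ ≤ s ^ 2 * 1 := by gcongr
        _ = s ^ 2 := mul_one _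
    have h2 : ((R - Q) Φ).re = (R Φ).re - (Q Φ).re := by simp
    have h3 := (Complex.re_le_norm ((R - Q) Φ))
    linarith
  have hclose := vectorFunctional_sum_close A U V hΦ1 hUsum hVsum (hQUV ▸ hQΦ) (by positivity)
  rw [← hQUV] at hclose
  have hUF := hn ι U hUsum hUe
  obtain ⟨σ, hσ⟩ := exists_signSum hL2 U hF hF0 (l := l) (η := η) hD.le
  set w : H := signSum U Finset.univ σ with hw
  have hPU : ∀ j, P (U j) = U j := fun j => by simp only [U]; rw [map_smul, hPu]
  have hPw : P w = w := by
    rw [hw, signSum, map_sum]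
    refine Finset.sum_congr rfl fun j _ => ?_
    split_ifs
    · exact hPU j
    · rw [map_neg, hPU]
  have hPΦ : ∀ f : H, P (OpSpace.op Φ f) = OpSpace.op Φ (P f) := fun f =>
    RKHS.ext fun x => by rw [hP, hφ, hφ, hP]; ring
  have hI := norm_sum_vectorFunctional_sub_le hL2 hH hA hφ hφ1 U w l
  have hsl : √l ^ 2 = l := Real.sq_sqrt hl0.le
  let a : H := ((√l : ℝ) : ℂ) • w
  have hna : ‖a‖ ^ 2 = l * ‖w‖ ^ 2 := by
    simp only [a]
    rw [norm_smul, mul_pow, Complex.norm_real, Real.norm_eq_abs, sq_abs, hsl]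
  have hab : vectorFunctional A a (OpSpace.op Φ a) =
      (l : ℂ) • vectorFunctional A w (OpSpace.op Φ w) := by
    simp only [a]
    rw [map_smul, vectorFunctional_smul_left, vectorFunctional_smul_right, smul_smul,
      Complex.conj_ofReal, ← Complex.ofReal_mul, ← sq, hsl]
  have hRa : ‖R - vectorFunctional A a (OpSpace.op Φ a)‖ ≤
      s ^ 2 + 2 * s + ∫ x, |∑ j, ‖U j x‖ ^ 2 - l * ‖w x‖ ^ 2| ∂μ := by
    have : R - vectorFunctional A a (OpSpace.op Φ a) = (R - Q) +
        (Q - ∑ j, vectorFunctional A (U j) (OpSpace.op Φ (U j))) +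
        (∑ j, vectorFunctional A (U j) (OpSpace.op Φ (U j)) -
          (l : ℂ) • vectorFunctional A w (OpSpace.op Φ w)) := by
      rw [hab]; abel
    rw [this]
    refine (norm_add₃_le).trans ?_
    gcongr
  have hcoef : (1 - η * l + 3 / 2 * l ^ 2) * ∑ j, ‖U j‖ ^ 2 ≤ 1 - η ^ 2 / 6 := by
    have h1 : 1 - η * l + 3 / 2 * l ^ 2 = 1 - η ^ 2 / 6 := by simp only [l]; ring
    rw [h1]
    have : η ^ 2 ≤ 1 := pow_le_one₀ hη0.le hη1
    exact mul_le_of_le_one_right (by linarith) hUsum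
  have hDs : D * ∫ x, √(∑ j, ‖U j x‖ ^ 2) * F x ∂μ ≤ s := by
    calc D * ∫ x, √(∑ j, ‖U j x‖ ^ 2) * F x ∂μ ≤ D * (s * τ / 2) := by gcongr
      _ = s := by simp only [D]; field_simp
  have hwF0 : 0 ≤ ∫ x, ‖w x‖ * F x ∂μ :=
    integral_nonneg fun x => mul_nonneg (norm_nonneg _) (hF0 x)
  have hI0 : 0 ≤ ∫ x, |∑ j, ‖U j x‖ ^ 2 - l * ‖w x‖ ^ 2| ∂μ := integral_nonneg fun x => abs_nonneg _
  have hη' : 0 ≤ (1 - η) * (l * ‖w‖ ^ 2) := mul_nonneg (by linarith) (by positivity)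
  refine ⟨a, OpSpace.op Φ a, ?_, ?_, fun x => ?_, ?_, ?_⟩
  · simp only [a]; rw [map_smul, hPw]
  · rw [hPΦ]; simp only [a]; rw [map_smul, hPw]
  · rw [hφ, norm_mul]; exact mul_le_of_le_one_left (norm_nonneg _) (hφ1 x)
  · rw [hna]
    have h1 : 0 ≤ D * ∫ x, ‖w x‖ * F x ∂μ := mul_nonneg hD.le hwF0
    have h2 : s ^ 2 ≤ s := by nlinarith
    have h3 : 4 * s = η ^ 2 / 24 := by simp only [s]; ring
    have h4 : 0 < η ^ 2 := by positivity
    linarith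
  · have h1 : D * ∫ x, ‖w x‖ * F x ∂μ ≤ 2 := by
      have h4 : 0 < η ^ 2 := by positivity
      linarith
    have h2 : ∫ x, ‖w x‖ * F x ∂μ ≤ τ := by
      have h3 : D * ∫ x, ‖w x‖ * F x ∂μ = 2 * (∫ x, ‖w x‖ * F x ∂μ) / τ := by
        simp only [D]; ring
      rw [h3, div_le_iff₀ hτ] at h1
      linarith
    have h3 : ∀ x, ‖a x‖ * F x = √l * (‖w x‖ * F x) := fun x => by
      simp only [a]
      rw [RKHS.coe_smul, Pi.smul_apply, norm_smul, Complex.norm_real, Real.norm_eq_abs,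
        abs_of_nonneg (Real.sqrt_nonneg l), mul_assoc]
    simp_rw [h3]
    rw [integral_const_mul]
    have h4 : √l ≤ 1 := by
      rw [Real.sqrt_le_iff]; simp only [l]; constructor <;> linarith
    exact (mul_le_of_le_one_left hwF0 h4).trans h2

/-- Subtracting a suitable vector functional decreases the norm of a functional by a fixed factor;
the amount is controlled by the squared norm of the vector, and the vector is small against a
given function in `L²`. -/
lemma exists_reduction [SigmaFinite μ] (hL2 : IsSubspaceL2 H μ)
    (hH : ∀ x : X, ∃ f : H, f x ≠ 0) (hA : IsDualAlgebraOfMultipliers A) (hPA : P ∈ A)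
    (hP : IsMulOp P ((component A x₀).indicator fun _ => (1 : ℂ)))
    (hnc : ∃ θ ∈ symbols A, ∃ y ∈ component A x₀, ∃ z ∈ component A x₀, θ y ≠ θ z)
    {R : StrongDual ℂ (OpSpace A)} (hR : R ∈ predual A) (hR0 : R ≠ 0)
    (hRP : ∀ T : OpSpace A, R (OpSpace.of (P * OpSpace.op T) (A.mul_mem hPA T.op_mem)) = R T)
    {F : X → ℝ} (hF : MemLp F 2 μ) (hF0 : ∀ x, 0 ≤ F x) {η τ : ℝ} (hη0 : 0 < η) (hη1 : η ≤ 1)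
    (hτ : 0 < τ) :
    ∃ a b : H, P a = a ∧ P b = b ∧ (∀ x, ‖b x‖ ≤ ‖a x‖) ∧
      ‖R - vectorFunctional A a b‖ + (1 - η) * ‖a‖ ^ 2 ≤ (1 - η ^ 2 / 12) * ‖R‖ ∧
      ∫ x, ‖a x‖ * F x ∂μ ≤ τ := by
  set r := ‖R‖ with hr
  have hr0 : 0 < r := norm_pos_iff.2 hR0
  have hrC : (r : ℂ) ≠ 0 := by exact_mod_cast hr0.ne'
  have hsr : √r ^ 2 = r := Real.sq_sqrt hr0.le
  have hsr0 : 0 < √r := Real.sqrt_pos.2 hr0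
  obtain ⟨a, b, ha, hb, hba, hle, hint⟩ := exists_reduction_of_norm_eq_one hL2 hH hA hPA hP hnc
    (R := ((r : ℂ))⁻¹ • R) ((predual A).smul_mem _ hR)
    (by rw [norm_smul, norm_inv, Complex.norm_real, Real.norm_of_nonneg hr0.le, ← hr,
      inv_mul_cancel₀ hr0.ne'])
    (fun T => by simp only [smul_apply]; rw [hRP]) hF hF0 hη0 hη1
    (show 0 < τ / √r by positivity)
  refine ⟨((√r : ℝ) : ℂ) • a, ((√r : ℝ) : ℂ) • b, by rw [map_smul, ha], by rw [map_smul, hb],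
    fun x => ?_, ?_, ?_⟩
  · simp only [RKHS.coe_smul, Pi.smul_apply, norm_smul]
    gcongr
    exact hba x
  · have h1 : R - vectorFunctional A (((√r : ℝ) : ℂ) • a) (((√r : ℝ) : ℂ) • b) =
        (r : ℂ) • (((r : ℂ))⁻¹ • R - vectorFunctional A a b) := by
      rw [vectorFunctional_smul_left, vectorFunctional_smul_right, smul_smul, Complex.conj_ofReal,
        ← Complex.ofReal_mul, ← sq, hsr, smul_sub, smul_smul, mul_inv_cancel₀ hrC, one_smul]
    rw [h1, norm_smul, norm_smul, Complex.norm_real, Complex.norm_real, Real.norm_of_nonneg hr0.le,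
      mul_pow, Real.norm_of_nonneg hsr0.le, hsr]
    nlinarith
  · have h3 : ∀ x, ‖(((√r : ℝ) : ℂ) • a) x‖ * F x = √r * (‖a x‖ * F x) := fun x => by
      rw [RKHS.coe_smul, Pi.smul_apply, norm_smul, Complex.norm_real, Real.norm_eq_abs,
        abs_of_nonneg hsr0.le, mul_assoc]
    simp_rw [h3]
    rw [integral_const_mul]
    calc √r * ∫ x, ‖a x‖ * F x ∂μ ≤ √r * (τ / √r) := by gcongr
      _ = τ := by field_simp

end Reduction

/-! ### Vectors supported on a component -/

section Support

variable {X H : Type*} [NormedAddCommGroup H] [InnerProductSpace ℂ H] [RKHS ℂ H X ℂ]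
  {A : Subalgebra ℂ (H →L[ℂ] H)} {P : H →L[ℂ] H}

/-- The functional `T ↦ ⟨T f, g⟩` is supported on `E` if `f` is. -/
lemma vectorFunctional_comp_of_apply_eq (hA : IsDualAlgebraOfMultipliers A) (hPA : P ∈ A) {E : Set X}
    (hP : IsMulOp P (E.indicator fun _ => (1 : ℂ))) {f : H} (hf : P f = f) (g : H)
    (T : OpSpace A) :
    vectorFunctional A f g (OpSpace.of (P * OpSpace.op T) (A.mul_mem hPA T.op_mem)) =
      vectorFunctional A f g T := by
  obtain ⟨ψ, hψ⟩ := hA.subset_multipliers T.op_mem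
  have : P (OpSpace.op T f) = OpSpace.op T f := by
    conv_rhs => rw [← hf]
    exact RKHS.ext fun x => by rw [hP, hψ, hψ, hP]; ring
  simp [this]

/-- Finitely many nonzero functionals have a common vector at which none vanishes; applying `P`
changes no value on `E`. -/
lemma exists_forall_apply_ne_zero (hH : ∀ x : X, ∃ f : H, f x ≠ 0) {E : Set X}
    (hP : IsMulOp P (E.indicator fun _ => (1 : ℂ))) {s : Finset X} (hs : ∀ y ∈ s, y ∈ E) :
    ∃ f : H, P f = f ∧ ∀ y ∈ s, f y ≠ 0 := by
  obtain ⟨f, hf⟩ := Module.Dual.exists_forall_ne_zero_of_forall_exists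
    (fun y : s => (LinearMap.proj (y : X)).comp (RKHS.coeCLM ℂ (H := H)).toLinearMap)
    fun y => hH y
  refine ⟨P f, RKHS.ext fun x => ?_, fun y hy => ?_⟩
  · rw [hP, hP]
    by_cases h : x ∈ E <;> simp [h]
  · rw [hP, Set.indicator_of_mem (hs y hy), one_mul]
    exact hf ⟨y, hy⟩

end Support

/-! ### Factorization by successive corrections -/

section Factorization

variable {X H : Type*} [MeasurableSpace X] {μ : Measure X} [NormedAddCommGroup H]
  [InnerProductSpace ℂ H] [RKHS ℂ H X ℂ]

lemma IsSubspaceL2.integrable_norm_mul_norm (hL2 : IsSubspaceL2 H μ) (f g : H) :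
    Integrable (fun x => ‖f x‖ * ‖g x‖) μ := by
  simpa using (hL2.integrable_mul f g).norm

lemma IsSubspaceL2.norm_inner_le_integral (hL2 : IsSubspaceL2 H μ) (f g : H) :
    ‖inner ℂ f g‖ ≤ ∫ x, ‖f x‖ * ‖g x‖ ∂μ := by
  rw [hL2.inner_eq_integral]
  refine (norm_integral_le_integral_norm _).trans_eq ?_
  simp

lemma IsSubspaceL2.integral_norm_mul_norm_le (hL2 : IsSubspaceL2 H μ) {g a b : H}
    (hba : ∀ x, ‖b x‖ ≤ ‖a x‖) {F : X → ℝ} (hF : MemLp F 2 μ) (hgF : ∀ x, ‖g x‖ ≤ F x) :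
    ∫ x, ‖b x‖ * ‖g x‖ ∂μ ≤ ∫ x, ‖a x‖ * F x ∂μ := by
  refine integral_mono (hL2.integrable_norm_mul_norm b g)
    ((hL2.memLp a).norm.integrable_mul hF) fun x => ?_
  have := hba x
  have := hgF x
  dsimp only
  gcongr

variable [CompleteSpace H] {A : Subalgebra ℂ (H →L[ℂ] H)}

/-- This bound sees how little |f| and |g| overlap, unlike the product of norms; it makes cross
terms small. -/
lemma norm_vectorFunctional_le_integral (hL2 : IsSubspaceL2 H μ)
    (hH : ∀ x : X, ∃ f : H, f x ≠ 0) (hA : IsDualAlgebraOfMultipliers A) (f g : H) :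
    ‖vectorFunctional A f g‖ ≤ ∫ x, ‖f x‖ * ‖g x‖ ∂μ := by
  refine ContinuousLinearMap.opNorm_le_bound _
    (integral_nonneg fun x => mul_nonneg (norm_nonneg _) (norm_nonneg _)) fun T => ?_
  obtain ⟨ψ, hψ⟩ := hA.subset_multipliers T.op_mem
  rw [vectorFunctional_apply]
  refine (hL2.norm_inner_le_integral _ _).trans ?_
  rw [← integral_mul_const]
  refine integral_mono (hL2.integrable_norm_mul_norm _ _)
    ((hL2.integrable_norm_mul_norm f g).mul_const _) fun x => ?_
  have h3 : ‖ψ x‖ ≤ ‖T‖ := by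
    rw [← OpSpace.op.norm_map]; exact hψ.norm_apply_le_opNorm (hH x)
  dsimp only
  rw [hψ, norm_mul]
  calc ‖g x‖ * (‖ψ x‖ * ‖f x‖) ≤ ‖g x‖ * (‖T‖ * ‖f x‖) := by gcongr
    _ = ‖f x‖ * ‖g x‖ * ‖T‖ := by ring

variable {P : H →L[ℂ] H} {x₀ : X}

/-- One step of the factorization: `(f, g)` is replaced by a pair for which `⟨T f, g⟩` is closer
to `L`, without changing the values of `f` at the points of `s` very much. -/
lemma exists_improved_pair [SigmaFinite μ] (hL2 : IsSubspaceL2 H μ)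
    (hH : ∀ x : X, ∃ f : H, f x ≠ 0) (hA : IsDualAlgebraOfMultipliers A) (hPA : P ∈ A)
    (hP : IsMulOp P ((component A x₀).indicator fun _ => (1 : ℂ)))
    (hnc : ∃ θ ∈ symbols A, ∃ y ∈ component A x₀, ∃ z ∈ component A x₀, θ y ≠ θ z)
    {L : StrongDual ℂ (OpSpace A)} (hL : L ∈ predual A)
    (hLP : ∀ T : OpSpace A, L (OpSpace.of (P * OpSpace.op T) (A.mul_mem hPA T.op_mem)) = L T)
    {f g : H} (hf : P f = f) (hg : P g = g) (s : Finset X) {η δ : ℝ} (hη0 : 0 < η) (hη1 : η < 1)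
    (hδ : 0 < δ) :
    ∃ f' g' : H, P f' = f' ∧ P g' = g' ∧
      ‖L - vectorFunctional A f' g'‖ ≤ (1 - η ^ 2 / 24) * ‖L - vectorFunctional A f g‖ ∧
      (1 - η) * ‖f' - f‖ ^ 2 ≤ ‖L - vectorFunctional A f g‖ ∧
      (1 - η) * ‖g' - g‖ ^ 2 ≤ ‖L - vectorFunctional A f g‖ ∧
      (1 - η) * ‖f'‖ ^ 2 + ‖L - vectorFunctional A f' g'‖ ≤
        (1 - η) * ‖f‖ ^ 2 + ‖L - vectorFunctional A f g‖ ∧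
      (1 - η) * ‖g'‖ ^ 2 + ‖L - vectorFunctional A f' g'‖ ≤
        (1 - η) * ‖g‖ ^ 2 + ‖L - vectorFunctional A f g‖ ∧
      ∀ y ∈ s, ‖f' y - f y‖ ≤ δ := by
  set R := L - vectorFunctional A f g with hRdef
  by_cases hR0 : R = 0
  · refine ⟨f, g, hf, hg, ?_, ?_, ?_, ?_, ?_, ?_⟩ <;> simp [← hRdef, hR0, hδ.le]
  have hr0 : 0 < ‖R‖ := norm_pos_iff.2 hR0
  -- Two cross terms and one inner product cost at most 4τ ≤ (η²/24)‖R‖, half of the gain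
  -- (η²/12)‖R‖.
  set τ : ℝ := min (η ^ 2 / 96 * ‖R‖) δ with hτdef
  have hτ : 0 < τ := lt_min (by positivity) hδ
  have hτ1 : τ ≤ η ^ 2 / 96 * ‖R‖ := min_le_left _ _
  -- Smallness of `a` against this one function controls the cross terms, the inner products of the
  -- corrections with `f` and `g`, and, through the kernel vectors, the change of value at the
  -- points of `s`.
  let F : X → ℝ := fun x => ‖f x‖ + ‖g x‖ + ∑ y ∈ s, ‖evalVec H y x‖
  have hF : MemLp F 2 μ := ((hL2.memLp f).norm.add (hL2.memLp g).norm).add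
    (memLp_finsetSum _ fun y _ => (hL2.memLp (evalVec H y)).norm)
  have hS0 : ∀ x, 0 ≤ ∑ y ∈ s, ‖evalVec H y x‖ := fun x =>
    Finset.sum_nonneg fun y _ => norm_nonneg _
  have hfF : ∀ x, ‖f x‖ ≤ F x := fun x => by
    have := hS0 x; have := norm_nonneg (g x); simp only [F]; linarith
  have hgF : ∀ x, ‖g x‖ ≤ F x := fun x => by
    have := hS0 x; have := norm_nonneg (f x); simp only [F]; linarith
  have heF : ∀ y ∈ s, ∀ x, ‖evalVec H y x‖ ≤ F x := fun y hy x => by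
    have h1 := norm_nonneg (f x)
    have h2 := norm_nonneg (g x)
    have h3 := Finset.single_le_sum (f := fun y => ‖evalVec H y x‖)
      (fun y _ => norm_nonneg _) hy
    simp only [F] at h3 ⊢; linarith
  obtain ⟨a, b, ha, hb, hba, hdrop, hint⟩ := exists_reduction hL2 hH hA hPA hP hnc
    ((predual A).sub_mem hL (vectorFunctional_mem_predual A f g)) hR0
    (fun T => by
      have h1 := vectorFunctional_comp_of_apply_eq hA hPA hP hf g T
      have h2 := hLP T
      simp only [sub_apply, h1, h2])
    hF (fun x => (norm_nonneg _).trans (hfF x)) hη0 hη1.le hτ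
  have haa : ∀ x, ‖a x‖ ≤ ‖a x‖ := fun _ => le_rfl
  have hnba : ‖b‖ ≤ ‖a‖ := by
    simpa using hL2.norm_le_of_norm_apply_le zero_le_one (f := b) (g := a) (by simpa using hba)
  have hag : ‖vectorFunctional A a g‖ ≤ τ :=
    (norm_vectorFunctional_le_integral hL2 hH hA a g).trans
      ((hL2.integral_norm_mul_norm_le haa hF hgF).trans hint)
  have hfb : ‖vectorFunctional A f b‖ ≤ τ := by
    refine (norm_vectorFunctional_le_integral hL2 hH hA f b).trans
      (le_trans (le_of_eq ?_) ((hL2.integral_norm_mul_norm_le hba hF hfF).trans hint))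
    simp_rw [mul_comm]
  have hinner : ∀ {h c : H}, (∀ x, ‖c x‖ ≤ ‖a x‖) → (∀ x, ‖h x‖ ≤ F x) →
      ‖inner ℂ h c‖ ≤ τ := fun {h c} hc hh => by
    rw [norm_inner_symm]
    exact (hL2.norm_inner_le_integral c h).trans
      ((hL2.integral_norm_mul_norm_le hc hF hh).trans hint)
  have hsq : ∀ {h c : H}, (∀ x, ‖c x‖ ≤ ‖a x‖) → (∀ x, ‖h x‖ ≤ F x) → ‖c‖ ≤ ‖a‖ →
      ‖h + c‖ ^ 2 ≤ ‖h‖ ^ 2 + 2 * τ + ‖a‖ ^ 2 := fun {h c} hc hh hca => by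
    rw [norm_add_sq (𝕜 := ℂ)]
    have h1 := (RCLike.re_le_norm (inner ℂ h c)).trans (hinner hc hh)
    have h2 : ‖c‖ ^ 2 ≤ ‖a‖ ^ 2 := by gcongr
    linarith
  have hR' : ‖L - vectorFunctional A (f + a) (g + b)‖ ≤
      ‖R - vectorFunctional A a b‖ + 2 * τ := by
    have : L - vectorFunctional A (f + a) (g + b) = R - vectorFunctional A a b -
        vectorFunctional A a g - vectorFunctional A f b := by
      rw [hRdef, vectorFunctional_add_left, vectorFunctional_add_right, vectorFunctional_add_right]
      abel
    rw [this]
    have h1 := norm_sub_le (R - vectorFunctional A a b - vectorFunctional A a g)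
      (vectorFunctional A f b)
    have h2 := norm_sub_le (R - vectorFunctional A a b) (vectorFunctional A a g)
    linarith
  have hη' : 0 < 1 - η := by linarith
  have ha0 : 0 ≤ (1 - η) * ‖a‖ ^ 2 := by positivity
  have hb2 : (1 - η) * ‖b‖ ^ 2 ≤ (1 - η) * ‖a‖ ^ 2 := by gcongr
  have hn0 := norm_nonneg (R - vectorFunctional A a b)
  have hκ : 0 < η ^ 2 * ‖R‖ := by positivity
  have hητ : 0 < η * τ := by positivity
  refine ⟨f + a, g + b, by rw [map_add, hf, ha], by rw [map_add, hg, hb], ?_, ?_, ?_, ?_, ?_, ?_⟩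
  · linarith
  · rw [add_sub_cancel_left]; linarith
  · rw [add_sub_cancel_left]; linarith
  · have := mul_le_mul_of_nonneg_left (hsq haa hfF le_rfl) hη'.le
    linarith
  · have := mul_le_mul_of_nonneg_left (hsq hba hgF hnba) hη'.le
    linarith
  · intro y hy
    rw [RKHS.coe_add, Pi.add_apply, add_sub_cancel_left, ← inner_evalVec]
    exact (hinner haa (heF y hy)).trans (min_le_right _ _)

/-- A functional in the predual supported on a component on which `A` is not constant is a vector
functional; the norms are nearly optimal, and the first vector is close to a given one on a finite
set. -/
lemma exists_eq_vectorFunctional_near [SigmaFinite μ] (hL2 : IsSubspaceL2 H μ)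
    (hH : ∀ x : X, ∃ f : H, f x ≠ 0) (hA : IsDualAlgebraOfMultipliers A) (hPA : P ∈ A)
    (hP : IsMulOp P ((component A x₀).indicator fun _ => (1 : ℂ)))
    (hnc : ∃ θ ∈ symbols A, ∃ y ∈ component A x₀, ∃ z ∈ component A x₀, θ y ≠ θ z)
    {L : StrongDual ℂ (OpSpace A)} (hL : L ∈ predual A)
    (hLP : ∀ T : OpSpace A, L (OpSpace.of (P * OpSpace.op T) (A.mul_mem hPA T.op_mem)) = L T)
    {f₀ : H} (hf₀ : P f₀ = f₀) (s : Finset X) {η δ : ℝ} (hη0 : 0 < η) (hη1 : η < 1)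
    (hδ : 0 < δ) :
    ∃ f g : H, L = vectorFunctional A f g ∧ (1 - η) * ‖f‖ ^ 2 ≤ (1 - η) * ‖f₀‖ ^ 2 + ‖L‖ ∧
      (1 - η) * ‖g‖ ^ 2 ≤ ‖L‖ ∧ ∀ y ∈ s, ‖f y - f₀ y‖ ≤ δ := by
  let Q := {p : H × H // P p.1 = p.1 ∧ P p.2 = p.2}
  let res : Q → ℝ := fun p => ‖L - vectorFunctional A p.1.1 p.1.2‖
  have hstep : ∀ (k : ℕ) (p : Q), ∃ q : Q, res q ≤ (1 - η ^ 2 / 24) * res p ∧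
      (1 - η) * ‖q.1.1 - p.1.1‖ ^ 2 ≤ res p ∧ (1 - η) * ‖q.1.2 - p.1.2‖ ^ 2 ≤ res p ∧
      (1 - η) * ‖q.1.1‖ ^ 2 + res q ≤ (1 - η) * ‖p.1.1‖ ^ 2 + res p ∧
      (1 - η) * ‖q.1.2‖ ^ 2 + res q ≤ (1 - η) * ‖p.1.2‖ ^ 2 + res p ∧
      ∀ y ∈ s, ‖q.1.1 y - p.1.1 y‖ ≤ δ / 2 / 2 ^ k := fun k p => by
    obtain ⟨f', g', h1, h2, h3⟩ := exists_improved_pair hL2 hH hA hPA hP hnc hL hLP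
      p.2.1 p.2.2 s hη0 hη1 (show 0 < δ / 2 / 2 ^ k by positivity)
    exact ⟨⟨(f', g'), h1, h2⟩, h3⟩
  choose step hstep using hstep
  -- Starting from (f₀, 0), the residual decays geometrically and each step is at most a constant
  -- times its square root, so both components are Cauchy.
  let q : ℕ → Q := fun k => Nat.rec ⟨(f₀, 0), hf₀, map_zero P⟩ (fun k p => step k p) k
  have hq : ∀ k, q (k + 1) = step k (q k) := fun _ => rfl
  have hstep' : ∀ k, _ := fun k => hstep k (q k)
  simp only [← hq] at hstep'
  have hη' : 0 < 1 - η := by linarith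
  have hρ0 : 0 < 1 - η ^ 2 / 24 := by nlinarith
  have hρ1 : 1 - η ^ 2 / 24 < 1 := by nlinarith
  have hres0 : res (q 0) = ‖L‖ := by
    change ‖L - vectorFunctional A f₀ 0‖ = ‖L‖
    congr 1
    ext T
    simp
  have hres : ∀ k, res (q k) ≤ (1 - η ^ 2 / 24) ^ k * ‖L‖ := fun k => by
    induction k with
    | zero => simp [hres0]
    | succ k ih =>
      refine (hstep' k).1.trans ?_
      rw [pow_succ' _ k, mul_assoc]
      exact mul_le_mul_of_nonneg_left ih hρ0.le
  have hdist : ∀ {u v : H} (k : ℕ), (1 - η) * ‖v - u‖ ^ 2 ≤ res (q k) →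
      dist u v ≤ √(‖L‖ / (1 - η)) * √(1 - η ^ 2 / 24) ^ k := fun {u v} k h => by
    rw [dist_comm, dist_eq_norm]
    refine le_of_sq_le_sq ?_ (by positivity)
    rw [mul_pow, ← pow_mul, mul_comm k, pow_mul, Real.sq_sqrt hρ0.le,
      Real.sq_sqrt (by positivity), div_mul_eq_mul_div, le_div_iff₀ hη']
    linarith [h.trans (hres k)]
  have hr1 : √(1 - η ^ 2 / 24) < 1 := by
    rw [Real.sqrt_lt' one_pos]; linarith
  obtain ⟨f, hf⟩ := cauchySeq_tendsto_of_complete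
    (cauchySeq_of_le_geometric (f := fun k => (q k).1.1) _ _ hr1
      fun k => hdist k (hstep' k).2.1)
  obtain ⟨g, hg⟩ := cauchySeq_tendsto_of_complete
    (cauchySeq_of_le_geometric (f := fun k => (q k).1.2) _ _ hr1
      fun k => hdist k (hstep' k).2.2.1)
  have hres_lim : Filter.Tendsto (fun k => res (q k)) Filter.atTop (𝓝 0) := by
    refine squeeze_zero (fun k => norm_nonneg _) hres ?_
    simpa using (tendsto_pow_atTop_nhds_zero_of_lt_one hρ0.le hρ1).mul_const ‖L‖
  -- The weighted squared norm plus the residual never increases; this telescoping, not the triangle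
  -- inequality, gives nearly optimal norms.
  have hfle : ∀ k, (1 - η) * ‖(q k).1.1‖ ^ 2 + res (q k) ≤ (1 - η) * ‖f₀‖ ^ 2 + ‖L‖ := fun k => by
    induction k with
    | zero => rw [hres0]; exact le_rfl
    | succ k ih => exact (hstep' k).2.2.2.1.trans ih
  have hgle : ∀ k, (1 - η) * ‖(q k).1.2‖ ^ 2 + res (q k) ≤ ‖L‖ := fun k => by
    induction k with
    | zero => rw [hres0]; simp [q]
    | succ k ih => exact (hstep' k).2.2.2.2.1.trans ih
  refine ⟨f, g, ?_, ?_, ?_, fun y hy => ?_⟩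
  · ext T
    have h1 : Filter.Tendsto (fun k => inner ℂ (q k).1.2 (OpSpace.op T (q k).1.1)) Filter.atTop
        (𝓝 (inner ℂ g (OpSpace.op T f))) :=
      hg.inner (((OpSpace.op T).continuous.tendsto f).comp hf)
    refine tendsto_nhds_unique ?_ h1
    rw [tendsto_iff_norm_sub_tendsto_zero]
    refine squeeze_zero (fun k => norm_nonneg _) (fun k => ?_)
      (by simpa using hres_lim.mul_const ‖T‖)
    rw [norm_sub_rev]
    exact (L - vectorFunctional A (q k).1.1 (q k).1.2).le_opNorm T
  · refine le_of_tendsto ((hf.norm.pow 2).const_mul (1 - η))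
      (Filter.Eventually.of_forall fun k => ?_)
    have : 0 ≤ res (q k) := norm_nonneg _
    linarith [hfle k]
  · refine le_of_tendsto ((hg.norm.pow 2).const_mul (1 - η))
      (Filter.Eventually.of_forall fun k => ?_)
    have : 0 ≤ res (q k) := norm_nonneg _
    linarith [hgle k]
  · have h1 : Filter.Tendsto (fun k => (q k).1.1 y) Filter.atTop (𝓝 (f y)) :=
      ((RKHS.continuous_eval y).tendsto f).comp hf
    have h2 := dist_le_of_le_geometric_two_of_tendsto₀ (C := δ) (f := fun k => (q k).1.1 y)
      (fun k => by rw [dist_comm, dist_eq_norm]; exact (hstep' k).2.2.2.2.2 y hy) h1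
    rw [dist_comm, dist_eq_norm] at h2
    exact h2

/-- A combination of point evaluations at points of one component is a vector functional with
nearly optimal norms. -/
lemma exists_vectorFunctional_eq_sum [SigmaFinite μ] (hL2 : IsSubspaceL2 H μ)
    (hH : ∀ x : X, ∃ f : H, f x ≠ 0) (hA : IsDualAlgebraOfMultipliers A) {ι : Type*} [Fintype ι]
    {x : ι → X} (hx : ∀ i, x i ∈ component A x₀) (c : ι → ℂ) {N : ℝ} (hN0 : 0 ≤ N)
    (hN : ∀ T ∈ A, ∀ ψ : X → ℂ, IsMulOp T ψ → ‖∑ i, c i * ψ (x i)‖ ≤ N * ‖T‖)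
    {ε : ℝ} (hε0 : 0 < ε) (hε1 : ε < 1) :
    ∃ f g : H, (∀ i, f (x i) ≠ 0) ∧ (1 - ε) * (‖f‖ * ‖g‖) ≤ N + ε ∧
      ∀ T ∈ A, ∀ ψ : X → ℂ, IsMulOp T ψ → inner ℂ g (T f) = ∑ i, c i * ψ (x i) := by
  classical
  obtain ⟨P, hPA, hP⟩ := isClopenFor_component hL2 hH hA x₀
  -- Including `x₀` keeps `f₀` nonzero even if there are no points.
  let s : Finset X := insert x₀ (Finset.univ.image x)
  have hxs : ∀ i, x i ∈ s := fun i => by simp [s]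
  obtain ⟨f₀, hPf₀, hf₀⟩ := exists_forall_apply_ne_zero hH hP (s := s) fun y hy => by
    rcases Finset.mem_insert.1 hy with rfl | hy
    · exact mem_component_self A y
    · obtain ⟨i, -, rfl⟩ := Finset.mem_image.1 hy
      exact hx i
  have hf₀0 : f₀ ≠ 0 := fun h => hf₀ x₀ (by simp [s]) (by simp [h])
  have hf₀n : 0 < ‖f₀‖ := norm_pos_iff.2 hf₀0
  by_cases hnc : ∃ θ ∈ symbols A, ∃ y ∈ component A x₀, ∃ z ∈ component A x₀, θ y ≠ θ z
  · let L : StrongDual ℂ (OpSpace A) := ∑ i, (c i * (evalVec H (x i) (x i))⁻¹) •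
      vectorFunctional A (evalVec H (x i)) (evalVec H (x i))
    have hLT : ∀ (T : OpSpace A) (ψ : X → ℂ), IsMulOp (OpSpace.op T) ψ →
        L T = ∑ i, c i * ψ (x i) := fun T ψ hψ => by
      simp only [L, sum_apply, smul_apply, vectorFunctional_apply, inner_evalVec, smul_eq_mul]
      refine Finset.sum_congr rfl fun i _ => ?_
      have : evalVec H (x i) (x i) ≠ 0 := by
        rw [← inner_evalVec, inner_self_ne_zero]; exact evalVec_ne_zero (hH _)
      rw [hψ]
      field_simp
    have hL : L ∈ predual A := Submodule.sum_mem _ fun i _ =>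
      Submodule.smul_mem _ _ (vectorFunctional_mem_predual A _ _)
    have hLP : ∀ T : OpSpace A,
        L (OpSpace.of (P * OpSpace.op T) (A.mul_mem hPA T.op_mem)) = L T := fun T => by
      obtain ⟨ψ, hψ⟩ := hA.subset_multipliers T.op_mem
      rw [hLT T ψ hψ, hLT _ _ (hP.mul hψ)]
      refine Finset.sum_congr rfl fun i _ => ?_
      simp only [Set.indicator_of_mem (hx i), one_mul]
    have hLN : ‖L‖ ≤ N := ContinuousLinearMap.opNorm_le_bound _ hN0 fun T => by
      obtain ⟨ψ, hψ⟩ := hA.subset_multipliers T.op_mem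
      rw [hLT T ψ hψ]
      exact hN _ T.op_mem ψ hψ
    -- The starting vector has squared norm ε, cheap enough for the final bound, and is nonzero at
    -- the points; changes below its least modulus there keep `f` nonzero.
    let t : ℝ := √ε / ‖f₀‖
    have ht : 0 < t := by positivity
    have htf : ‖(t : ℂ) • f₀‖ ^ 2 = ε := by
      rw [norm_smul, Complex.norm_real, Real.norm_of_nonneg ht.le]
      simp only [t]
      rw [div_mul_cancel₀ _ hf₀n.ne', Real.sq_sqrt hε0.le]
    have hδ : ∃ δ : ℝ, 0 < δ ∧ ∀ y ∈ s, δ < ‖((t : ℂ) • f₀) y‖ := by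
      have h1 : ∀ᶠ δ : ℝ in 𝓝[>] 0, ∀ y ∈ s, δ < ‖((t : ℂ) • f₀) y‖ := by
        rw [Filter.eventually_all_finset]
        intro y hy
        refine Filter.Eventually.filter_mono nhdsWithin_le_nhds (eventually_lt_nhds ?_)
        rw [norm_pos_iff, RKHS.coe_smul, Pi.smul_apply]
        exact smul_ne_zero (by exact_mod_cast ht.ne') (hf₀ y hy)
      obtain ⟨δ, h2, h3⟩ := (h1.and self_mem_nhdsWithin).exists
      exact ⟨δ, h3, h2⟩
    obtain ⟨δ, hδ0, hδ⟩ := hδ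
    obtain ⟨f, g, hfg, hf, hg, hfs⟩ := exists_eq_vectorFunctional_near hL2 hH hA hPA hP hnc hL hLP
      (f₀ := (t : ℂ) • f₀) (by rw [map_smul, hPf₀]) s hε0 hε1 hδ0
    refine ⟨f, g, fun i h0 => ?_, ?_, fun T hT ψ hψ => ?_⟩
    · have h1 := hfs _ (hxs i)
      rw [h0, zero_sub, norm_neg] at h1
      exact absurd h1 (not_le.2 (hδ _ (hxs i)))
    · rw [htf] at hf
      have h1 : (1 - ε) * (2 * (‖f‖ * ‖g‖)) ≤ (1 - ε) * (‖f‖ ^ 2 + ‖g‖ ^ 2) := by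
        refine mul_le_mul_of_nonneg_left ?_ (by linarith)
        nlinarith [sq_nonneg (‖f‖ - ‖g‖)]
      nlinarith
    · rw [← hLT (OpSpace.of T hT) ψ hψ, hfg]
      rfl
  -- If A is constant on the component, `f₀` is a common eigenvector and `g` can be an explicit
  -- multiple of it.
  · push Not at hnc
    have hTf : ∀ T ∈ A, ∀ ψ : X → ℂ, IsMulOp T ψ → T f₀ = ψ x₀ • f₀ := fun T hT ψ hψ =>
      RKHS.ext fun y => by
        rw [hψ, RKHS.coe_smul, Pi.smul_apply, smul_eq_mul]
        by_cases hy : y ∈ component A x₀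
        · rw [hnc ψ ⟨T, hT, hψ⟩ y hy x₀ (mem_component_self A x₀)]
        · rw [← hPf₀, hP, Set.indicator_of_notMem hy, zero_mul, mul_zero, mul_zero]
    have hf2 : ((‖f₀‖ : ℝ) : ℂ) ≠ 0 := by exact_mod_cast hf₀n.ne'
    refine ⟨f₀, (conj (∑ i, c i) / (‖f₀‖ : ℂ) ^ 2) • f₀, fun i => hf₀ _ (hxs i), ?_,
      fun T hT ψ hψ => ?_⟩
    · have h1 : ‖f₀‖ * ‖(conj (∑ i, c i) / (‖f₀‖ : ℂ) ^ 2) • f₀‖ = ‖∑ i, c i‖ := by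
        rw [norm_smul, norm_div, RCLike.norm_conj, norm_pow, Complex.norm_real, norm_norm]
        field_simp
      have h2 := hN 1 A.one_mem _ isMulOp_one
      simp only [mul_one] at h2
      have h3 : N * ‖(1 : H →L[ℂ] H)‖ ≤ N :=
        mul_le_of_le_one_right hN0 ContinuousLinearMap.norm_id_le
      rw [h1]
      have h4 := mul_le_of_le_one_left (norm_nonneg (∑ i, c i)) (show 1 - ε ≤ 1 by linarith)
      linarith
    · rw [hTf T hT ψ hψ, inner_smul_left, inner_smul_right, inner_self_eq_norm_sq_to_K]
      have h1 : ∀ i, ψ (x i) = ψ x₀ := fun i =>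
        hnc ψ ⟨T, hT, hψ⟩ _ (hx i) _ (mem_component_self A x₀)
      simp_rw [h1, ← Finset.sum_mul]
      simp only [map_div₀, map_pow, Complex.conj_conj, Complex.conj_ofReal, Complex.coe_algebraMap]
      field_simp

end Factorization

/-! ### Riesz representation and Pick matrices -/

section HilbertSpace

variable {V E : Type*} [AddCommGroup V] [Module ℂ V] [NormedAddCommGroup E]
  [InnerProductSpace ℂ E]

/-- The Riesz representation of a functional that is bounded in the norm induced by `τ`. -/
lemma exists_mem_closure_range_inner_eq [CompleteSpace E] (τ : V →ₗ[ℂ] E) (ℓ : V →ₗ[ℂ] ℂ) {C : ℝ}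
    (hC : 0 ≤ C) (h : ∀ v, ‖ℓ v‖ ≤ C * ‖τ v‖) :
    ∃ G ∈ (LinearMap.range τ).topologicalClosure, ‖G‖ ≤ C ∧ ∀ v, inner ℂ G (τ v) = ℓ v := by
  let W := (LinearMap.range τ).topologicalClosure
  have hW : IsClosed (W : Set E) := Submodule.isClosed_topologicalClosure _
  have : CompleteSpace W := hW.completeSpace_coe
  let e : V →ₗ[ℂ] W := τ.codRestrict W fun v => Submodule.le_topologicalClosure _ ⟨v, rfl⟩
  have hd : DenseRange e := by
    intro y
    rw [Topology.IsInducing.subtypeVal.closure_eq_preimage_closure_image]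
    have h1 : (y : E) ∈ closure (Set.range τ) := y.2
    convert h1 using 2
    rw [← Set.range_comp]
    rfl
  have hle : ∀ v, ‖ℓ v‖ ≤ C * ‖e v‖ := h
  let G : W := (InnerProductSpace.toDual ℂ W).symm (ℓ.extendOfNorm e)
  refine ⟨G, G.2, ?_, fun v => ?_⟩
  · have h1 : ‖G‖ ≤ C := by
      rw [LinearIsometryEquiv.norm_map]; exact LinearMap.opNorm_extendOfNorm_le hd hC hle
    exact h1
  · have h1 : inner ℂ G (e v) = ℓ v := by
      rw [InnerProductSpace.toDual_symm_apply, LinearMap.extendOfNorm_eq hd ⟨C, hle⟩]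
    exact h1

lemma norm_le_of_mem_closure_range (τ : V →ₗ[ℂ] E) {G : E} {C : ℝ}
    (hC : 0 ≤ C) (hG : G ∈ (LinearMap.range τ).topologicalClosure) (h : ∀ v, ‖inner ℂ G (τ v)‖ ≤ C * ‖τ v‖) :
    ‖G‖ ≤ C := by
  have h1 : ∀ y ∈ closure (LinearMap.range τ : Set E), ‖inner ℂ G y‖ ≤ C * ‖y‖ := by
    intro y hy
    refine closure_minimal (t := {y | ‖inner ℂ G y‖ ≤ C * ‖y‖}) ?_
      (isClosed_le (by fun_prop) (by fun_prop)) hy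
    rintro _ ⟨v, rfl⟩
    exact h v
  have h2 := h1 G hG
  rw [inner_self_eq_norm_sq_to_K, norm_pow] at h2
  simp only [Complex.coe_algebraMap, Complex.norm_real, norm_norm] at h2
  rcases (norm_nonneg G).eq_or_lt with h0 | h0
  · rwa [← h0]
  · nlinarith

/-- The Pick matrix of a family of vectors as a difference of Gram matrices. -/
lemma star_dotProduct_pick_mulVec {ι : Type*} [Fintype ι] (k : ι → E) (w z : ι → ℂ) :
    star z ⬝ᵥ Matrix.mulVec (Matrix.of fun i j => (1 - w i * conj (w j)) * inner ℂ (k i) (k j)) z =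
      ((‖∑ i, z i • k i‖ ^ 2 - ‖∑ i, (conj (w i) * z i) • k i‖ ^ 2 : ℝ) : ℂ) := by
  have h : ∀ a : ι → ℂ, ((‖∑ i, a i • k i‖ ^ 2 : ℝ) : ℂ) =
      ∑ i, ∑ j, conj (a i) * a j * inner ℂ (k i) (k j) := fun a => by
    have h1 := inner_self_eq_norm_sq_to_K (𝕜 := ℂ) (∑ i, a i • k i)
    rw [sum_inner] at h1
    push_cast
    rw [← Complex.coe_algebraMap, ← h1]
    refine Finset.sum_congr rfl fun i _ => ?_
    rw [inner_sum]
    refine Finset.sum_congr rfl fun j _ => ?_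
    rw [inner_smul_left, inner_smul_right, mul_assoc]
  rw [Complex.ofReal_sub, h, h, ← Finset.sum_sub_distrib]
  simp only [dotProduct, Matrix.mulVec, Matrix.of_apply, Pi.star_apply]
  refine Finset.sum_congr rfl fun i _ => ?_
  rw [Finset.mul_sum, ← Finset.sum_sub_distrib]
  refine Finset.sum_congr rfl fun j _ => ?_
  simp only [map_mul, Complex.conj_conj, RCLike.star_def]
  ring

/-- Positivity says that sending k_i to conj(w_i) k_i does not increase norms on the span, the form
in which both directions use it. -/
lemma posSemidef_pick_iff {ι : Type*} [Fintype ι] (k : ι → E) (w : ι → ℂ) :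
    (Matrix.of fun i j => (1 - w i * conj (w j)) * inner ℂ (k i) (k j)).PosSemidef ↔
      ∀ z : ι → ℂ, ‖∑ i, (conj (w i) * z i) • k i‖ ≤ ‖∑ i, z i • k i‖ := by
  rw [Matrix.posSemidef_iff_dotProduct_mulVec]
  simp_rw [star_dotProduct_pick_mulVec, Complex.zero_le_real, sub_nonneg]
  have : (Matrix.of fun i j => (1 - w i * conj (w j)) * inner ℂ (k i) (k j)).IsHermitian := by
    ext i j
    simp [mul_comm]
  simp only [this, true_and]
  refine forall_congr' fun z => ?_
  exact pow_le_pow_iff_left₀ (norm_nonneg _) (norm_nonneg _) two_ne_zero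

end HilbertSpace

/-! ### A choice of symbols -/

section Symbol

variable {X H : Type*} [NormedAddCommGroup H] [InnerProductSpace ℂ H] [RKHS ℂ H X ℂ]
  {A : Subalgebra ℂ (H →L[ℂ] H)}

/-- The function on `X` by which an element of an algebra of multipliers acts. -/
def symbol (hA : IsDualAlgebraOfMultipliers A) (T : OpSpace A) : X → ℂ :=
  (hA.subset_multipliers T.op_mem).choose

lemma isMulOp_symbol (hA : IsDualAlgebraOfMultipliers A) (T : OpSpace A) :
    IsMulOp (OpSpace.op T) (symbol hA T) :=
  (hA.subset_multipliers T.op_mem).choose_spec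

end Symbol

/-! ### The spaces A²(|f|²μ) and their kernels -/

section WeightedL2

variable {X H : Type*} [MeasurableSpace X] {μ : Measure X} [NormedAddCommGroup H]
  [InnerProductSpace ℂ H] [RKHS ℂ H X ℂ] {A : Subalgebra ℂ (H →L[ℂ] H)}

lemma eLpNorm_absSqMeasure (hL2 : IsSubspaceL2 H μ) {T : H →L[ℂ] H} {φ : X → ℂ}
    (hT : IsMulOp T φ) (f : H) : eLpNorm φ 2 (absSqMeasure f μ) = ‖T f‖ₑ := by
  rw [← (hL2 (T f)).2, eLpNorm_eq_lintegral_rpow_enorm_toReal two_ne_zero ENNReal.ofNat_ne_top,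
    eLpNorm_eq_lintegral_rpow_enorm_toReal two_ne_zero ENNReal.ofNat_ne_top, absSqMeasure,
    lintegral_withDensity_eq_lintegral_mul_non_measurable₀ _ ((hL2.memLp f).1.enorm.pow_const 2)
      (Filter.Eventually.of_forall fun x => by finiteness)]
  congr 2
  funext x
  simp only [Pi.mul_apply, ENNReal.toReal_ofNat, ENNReal.rpow_ofNat]
  rw [hT, enorm_mul, mul_pow, mul_comm]

/-- Measurability of φ comes from writing it as Tf/f, since f is nonzero almost everywhere for
|f|²μ. -/
lemma IsMulOp.memLp_absSqMeasure (hL2 : IsSubspaceL2 H μ) {T : H →L[ℂ] H} {φ : X → ℂ}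
    (hT : IsMulOp T φ) (f : H) : MemLp φ 2 (absSqMeasure f μ) := by
  refine ⟨?_, by rw [eLpNorm_absSqMeasure hL2 hT]; finiteness⟩
  have hac : absSqMeasure f μ ≪ μ := withDensity_absolutelyContinuous _ _
  have hne : ∀ᵐ x ∂absSqMeasure f μ, f x ≠ 0 := by
    rw [absSqMeasure, ae_withDensity_iff' ((hL2.memLp f).1.enorm.pow_const 2)]
    refine Filter.Eventually.of_forall fun x hx h0 => hx (by simp [h0])
  have hm : AEMeasurable (fun x => T f x / f x) (absSqMeasure f μ) :=
    ((hL2.memLp (T f)).1.aemeasurable.div (hL2.memLp f).1.aemeasurable).mono_ac hac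
  refine (hm.congr ?_).aestronglyMeasurable
  filter_upwards [hne] with x hx
  rw [hT, mul_div_cancel_right₀ _ hx]

/-- The map that sends `M_φ` in `A` to `φ` in `L²(|f|²μ)`. -/
def toWeightedL2 (hL2 : IsSubspaceL2 H μ) (hH : ∀ x : X, ∃ f : H, f x ≠ 0)
    (hA : IsDualAlgebraOfMultipliers A) (f : H) : OpSpace A →ₗ[ℂ] Lp ℂ 2 (absSqMeasure f μ) where
  toFun T := ((isMulOp_symbol hA T).memLp_absSqMeasure hL2 f).toLp (symbol hA T)
  map_add' S T := by
    rw [← MemLp.toLp_add]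
    refine MemLp.toLp_congr _ _ (Filter.Eventually.of_forall fun x => ?_)
    exact congrFun ((isMulOp_symbol hA (S + T)).unique hH (by
      rw [map_add]; exact (isMulOp_symbol hA S).add (isMulOp_symbol hA T))) x
  map_smul' c T := by
    rw [RingHom.id_apply, ← MemLp.toLp_const_smul]
    refine MemLp.toLp_congr _ _ (Filter.Eventually.of_forall fun x => ?_)
    exact congrFun ((isMulOp_symbol hA (c • T)).unique hH (by
      rw [map_smul]; exact (isMulOp_symbol hA T).smul c)) x

lemma toLp_eq_toWeightedL2 (hL2 : IsSubspaceL2 H μ) (hH : ∀ x : X, ∃ f : H, f x ≠ 0)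
    (hA : IsDualAlgebraOfMultipliers A) (f : H) (T : OpSpace A) {φ : X → ℂ} (hφ : IsMulOp (OpSpace.op T) φ)
    (h : MemLp φ 2 (absSqMeasure f μ)) : h.toLp φ = toWeightedL2 hL2 hH hA f T := by
  obtain rfl := hφ.unique hH (isMulOp_symbol hA T)
  rfl

lemma norm_toWeightedL2 (hL2 : IsSubspaceL2 H μ) (hH : ∀ x : X, ∃ f : H, f x ≠ 0)
    (hA : IsDualAlgebraOfMultipliers A) (f : H) (T : OpSpace A) :
    ‖toWeightedL2 hL2 hH hA f T‖ = ‖OpSpace.op T f‖ := by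
  change ‖((isMulOp_symbol hA T).memLp_absSqMeasure hL2 f).toLp _‖ = _
  rw [Lp.norm_toLp, eLpNorm_absSqMeasure hL2 (isMulOp_symbol hA T), toReal_enorm]

lemma closureL2_symbols (hL2 : IsSubspaceL2 H μ) (hH : ∀ x : X, ∃ f : H, f x ≠ 0)
    (hA : IsDualAlgebraOfMultipliers A) (f : H) : closureL2 (symbols A) (absSqMeasure f μ) =
    (LinearMap.range (toWeightedL2 hL2 hH hA f)).topologicalClosure := by
  rw [closureL2]
  congr 1
  have : {g | ∃ φ ∈ symbols A, ∃ h : MemLp φ 2 (absSqMeasure f μ), h.toLp φ = g} =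
      (LinearMap.range (toWeightedL2 hL2 hH hA f) : Set (Lp ℂ 2 (absSqMeasure f μ))) := by
    ext g
    constructor
    · rintro ⟨φ, ⟨T, hT, hφ⟩, h, rfl⟩
      exact ⟨OpSpace.of T hT, (toLp_eq_toWeightedL2 hL2 hH hA f (OpSpace.of T hT) hφ h).symm⟩
    · rintro ⟨T, rfl⟩
      exact ⟨symbol hA T, ⟨_, T.op_mem, isMulOp_symbol hA T⟩,
        (isMulOp_symbol hA T).memLp_absSqMeasure hL2 f, rfl⟩
  rw [this, Submodule.span_eq]

lemma isReproducingAt_iff (hL2 : IsSubspaceL2 H μ) (hH : ∀ x : X, ∃ f : H, f x ≠ 0)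
    (hA : IsDualAlgebraOfMultipliers A) (f : H) (x : X) (k : Lp ℂ 2 (absSqMeasure f μ)) :
    IsReproducingAt (symbols A) (absSqMeasure f μ) x k ↔
      k ∈ (LinearMap.range (toWeightedL2 hL2 hH hA f)).topologicalClosure ∧
        ∀ T, inner ℂ k (toWeightedL2 hL2 hH hA f T) = symbol hA T x := by
  rw [IsReproducingAt, closureL2_symbols hL2 hH hA]
  refine and_congr_right fun _ => ⟨fun h T => ?_, ?_⟩
  · exact h _ ⟨_, T.op_mem, isMulOp_symbol hA T⟩
      ((isMulOp_symbol hA T).memLp_absSqMeasure hL2 f)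
  · rintro h φ ⟨T, hT, hφ⟩ hm
    rw [toLp_eq_toWeightedL2 hL2 hH hA f (OpSpace.of T hT) hφ, h,
      hφ.unique hH (isMulOp_symbol hA (OpSpace.of T hT))]

lemma kernelVec_eq_zero_or (f : H) (x : X) :
    kernelVec (symbols A) (absSqMeasure f μ) x = 0 ∨
      IsReproducingAt (symbols A) (absSqMeasure f μ) x
        (kernelVec (symbols A) (absSqMeasure f μ) x) := by
  rw [kernelVec]
  split_ifs with h
  · exact Or.inr h.choose_spec
  · exact Or.inl rfl

/-- Evaluation at x is bounded, because φ(x) = (Tf)(x)/f(x) and the norm of φ in L²(|f|²μ) is ‖Tf‖.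
-/
lemma isReproducingAt_kernelVec [CompleteSpace H] (hL2 : IsSubspaceL2 H μ)
    (hH : ∀ x : X, ∃ f : H, f x ≠ 0) (hA : IsDualAlgebraOfMultipliers A) {f : H} {x : X} (hx : f x ≠ 0) :
    IsReproducingAt (symbols A) (absSqMeasure f μ) x
      (kernelVec (symbols A) (absSqMeasure f μ) x) := by
  have h : ∃ k, IsReproducingAt (symbols A) (absSqMeasure f μ) x k := by
    let ℓ : OpSpace A →ₗ[ℂ] ℂ :=
      { toFun := fun T => (f x)⁻¹ * inner ℂ (evalVec H x) (OpSpace.op T f)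
        map_add' := fun S T => by simp [mul_add]
        map_smul' := fun c T => by simp; ring }
    obtain ⟨k, hk, -, hkT⟩ := exists_mem_closure_range_inner_eq (toWeightedL2 hL2 hH hA f) ℓ
      (C := ‖f x‖⁻¹ * ‖evalVec H x‖) (by positivity) fun T => by
        rw [norm_toWeightedL2]
        change ‖(f x)⁻¹ * inner ℂ (evalVec H x) (OpSpace.op T f)‖ ≤ _
        rw [norm_mul, norm_inv, mul_assoc]
        gcongr
        exact norm_inner_le_norm _ _
    refine ⟨k, (isReproducingAt_iff hL2 hH hA f x k).2 ⟨hk, fun T => ?_⟩⟩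
    rw [hkT]
    change (f x)⁻¹ * inner ℂ (evalVec H x) (OpSpace.op T f) = _
    rw [inner_evalVec, isMulOp_symbol hA T]
    field_simp
  rw [kernelVec, dif_pos h]
  exact h.choose_spec

end WeightedL2

/-! ### From the Pick condition to interpolation -/

section Interpolation

variable {X H : Type*} [MeasurableSpace X] {μ : Measure X} [NormedAddCommGroup H]
  [InnerProductSpace ℂ H] [RKHS ℂ H X ℂ] {A : Subalgebra ℂ (H →L[ℂ] H)}

/-- The values of a function in the unit ball of `A` satisfy the Pick condition for `|f|²μ`. -/
lemma posSemidef_of_mem_symbolBall (hL2 : IsSubspaceL2 H μ) (hH : ∀ x : X, ∃ f : H, f x ≠ 0)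
    (hA : IsDualAlgebraOfMultipliers A) {ι : Type*} [Fintype ι] (x : ι → X) {φ : X → ℂ}
    (hφ : φ ∈ symbolBall A) (f : H) :
    (Matrix.of fun i j => (1 - φ (x i) * conj (φ (x j))) *
      kernelFn (symbols A) (absSqMeasure f μ) (x i) (x j)).PosSemidef := by
  obtain ⟨⟨Φ, hΦA, hΦ⟩, hφ1⟩ := hφ
  refine (posSemidef_pick_iff (fun i => kernelVec (symbols A) (absSqMeasure f μ) (x i))
    fun i => φ (x i)).2 fun z => ?_
  have hk := fun i => kernelVec_eq_zero_or (μ := μ) (A := A) f (x i)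
  simp only [isReproducingAt_iff hL2 hH hA] at hk
  set k := fun i => kernelVec (symbols A) (absSqMeasure f μ) (x i) with hkdef
  refine norm_le_of_mem_closure_range (toWeightedL2 hL2 hH hA f) (norm_nonneg _)
    (Submodule.sum_mem _ fun i _ => Submodule.smul_mem _ _ ?_) fun T => ?_
  · rcases hk i with h | h
    · exact h ▸ Submodule.zero_mem _
    · exact h.1
  -- The eigenvector relation for the adjoint, tested on A by replacing `T` with `Φ T`. It holds
  -- trivially for those `k i` that have the default value 0.
  · let S : OpSpace A := OpSpace.of (Φ * OpSpace.op T) (A.mul_mem hΦA T.op_mem)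
    have hS : symbol hA S = fun y => φ y * symbol hA T y :=
      (isMulOp_symbol hA S).unique hH (hΦ.mul (isMulOp_symbol hA T))
    have h1 : inner ℂ (∑ i, (conj (φ (x i)) * z i) • k i) (toWeightedL2 hL2 hH hA f T) =
        inner ℂ (∑ i, z i • k i) (toWeightedL2 hL2 hH hA f S) := by
      rw [sum_inner, sum_inner]
      refine Finset.sum_congr rfl fun i _ => ?_
      rw [inner_smul_left, inner_smul_left]
      rcases hk i with h | h
      · simp only [hkdef, h, inner_zero_left, mul_zero]
      · simp only [hkdef, h.2, hS, map_mul, Complex.conj_conj]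
        ring
    rw [h1]
    refine (norm_inner_le_norm _ _).trans (mul_le_mul_of_nonneg_left ?_ (norm_nonneg _))
    rw [norm_toWeightedL2, norm_toWeightedL2]
    have h2 := hL2.norm_le_of_norm_apply_le zero_le_one (f := Φ (OpSpace.op T f))
      (g := OpSpace.op T f) fun y => by
        rw [hΦ, norm_mul]; exact mul_le_mul_of_nonneg_right (hφ1 y) (norm_nonneg _)
    rwa [one_mul] at h2

variable [CompleteSpace H]

/-- The vector ∑ conj(c_i) k_i represents T ↦ ⟨Tf, g⟩ in A²(|f|²μ), so its norm is at most ‖g‖. The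
Pick condition carries this bound over to ∑ conj(w_i c_i) k_i, which is then paired with the
constant 1, of norm ‖f‖. -/
lemma norm_sum_mul_le_of_posSemidef (hL2 : IsSubspaceL2 H μ) (hH : ∀ x : X, ∃ f : H, f x ≠ 0)
    (hA : IsDualAlgebraOfMultipliers A) {ι : Type*} [Fintype ι] (x : ι → X) (w c : ι → ℂ) (f g : H)
    (hf : ∀ i, f (x i) ≠ 0)
    (hfg : ∀ T ∈ A, ∀ ψ : X → ℂ, IsMulOp T ψ → inner ℂ g (T f) = ∑ i, c i * ψ (x i))
    (hpos : (Matrix.of fun i j => (1 - w i * conj (w j)) *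
      kernelFn (symbols A) (absSqMeasure f μ) (x i) (x j)).PosSemidef) :
    ‖∑ i, c i * w i‖ ≤ ‖f‖ * ‖g‖ := by
  have hk := fun i => (isReproducingAt_iff hL2 hH hA f (x i) _).1
    (isReproducingAt_kernelVec hL2 hH hA (hf i))
  have hpick := (posSemidef_pick_iff (fun i => kernelVec (symbols A) (absSqMeasure f μ) (x i)) w).1
    hpos fun i => conj (c i)
  set k := fun i => kernelVec (symbols A) (absSqMeasure f μ) (x i) with hkdef
  set τ := toWeightedL2 hL2 hH hA f with hτ
  have hinner : ∀ (a : ι → ℂ) (T : OpSpace A),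
      inner ℂ (∑ i, a i • k i) (τ T) = ∑ i, conj (a i) * symbol hA T (x i) := fun a T => by
    rw [sum_inner]
    refine Finset.sum_congr rfl fun i _ => ?_
    rw [inner_smul_left, (hk i).2]
  have hG : ‖∑ i, conj (c i) • k i‖ ≤ ‖g‖ := by
    refine norm_le_of_mem_closure_range τ (norm_nonneg _)
      (Submodule.sum_mem _ fun i _ => Submodule.smul_mem _ _ (hk i).1) fun T => ?_
    rw [hinner]
    simp only [Complex.conj_conj]
    rw [← hfg _ T.op_mem _ (isMulOp_symbol hA T), hτ, norm_toWeightedL2]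
    exact norm_inner_le_norm _ _
  let I : OpSpace A := OpSpace.of 1 A.one_mem
  have hI : symbol hA I = fun _ => 1 := (isMulOp_symbol hA I).unique hH isMulOp_one
  have h1 := hinner (fun i => conj (w i) * conj (c i)) I
  simp only [hI, map_mul, Complex.conj_conj, mul_one] at h1
  simp_rw [mul_comm (c _), ← h1]
  refine (norm_inner_le_norm _ _).trans ?_
  rw [hτ, norm_toWeightedL2, mul_comm]
  exact mul_le_mul_of_nonneg_left (hpick.trans hG) (norm_nonneg _)

/-- Interpolation at points of one component. -/
lemma exists_mem_symbolBall_of_mem_component [SigmaFinite μ] (hL2 : IsSubspaceL2 H μ)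
    (hH : ∀ x : X, ∃ f : H, f x ≠ 0) (hA : IsDualAlgebraOfMultipliers A) {ι : Type*} [Fintype ι]
    {x₀ : X} {x : ι → X} (hx : ∀ i, x i ∈ component A x₀) (w : ι → ℂ)
    (hpos : ∀ f : H, (Matrix.of fun i j => (1 - w i * conj (w j)) *
      kernelFn (symbols A) (absSqMeasure f μ) (x i) (x j)).PosSemidef) :
    ∃ φ ∈ symbolBall A, ∀ i, φ (x i) = w i := by
  classical
  let r : (X → ℂ) → ι → ℂ := fun φ i => φ (x i)
  suffices h : w ∈ r '' symbolBall A by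
    obtain ⟨φ, hφ, hr⟩ := h
    exact ⟨φ, hφ, fun i => congrFun hr i⟩
  by_contra hw
  have hr : Continuous r := continuous_pi fun i => continuous_apply _
  have hconv : Convex ℝ (r '' symbolBall A) := by
    rintro _ ⟨φ, hφ, rfl⟩ _ ⟨ψ, hψ, rfl⟩ a b ha hb hab
    refine ⟨fun y => (a : ℂ) * φ y + (b : ℂ) * ψ y,
      ⟨add_mem_symbols (smul_mem_symbols _ hφ.1) (smul_mem_symbols _ hψ.1), fun y => ?_⟩, ?_⟩
    · refine (norm_add_le _ _).trans ?_
      rw [norm_mul, norm_mul, Complex.norm_real, Complex.norm_real, Real.norm_of_nonneg ha,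
        Real.norm_of_nonneg hb, ← hab]
      exact add_le_add (mul_le_of_le_one_right ha (hφ.2 y)) (mul_le_of_le_one_right hb (hψ.2 y))
    · funext i
      simp [r]
  obtain ⟨ℓ, N, hN, hNw⟩ := RCLike.geometric_hahn_banach_closed_point (𝕜 := ℂ) hconv
    ((isCompact_symbolBall hL2 hH hA).image hr).isClosed hw
  let c : ι → ℂ := fun i => ℓ (Pi.single i 1)
  have hℓ : ∀ v : ι → ℂ, ℓ v = ∑ i, c i * v i := fun v => by
    conv_lhs => rw [← Finset.univ_sum_single v, map_sum]
    refine Finset.sum_congr rfl fun i _ => ?_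
    rw [mul_comm, ← smul_eq_mul, ← map_smul, ← Pi.single_smul, smul_eq_mul, mul_one]
  have hN0 : 0 < N := by
    have h0 : (fun _ : X => (0 : ℂ)) ∈ symbolBall A :=
      ⟨by simpa using smul_mem_symbols 0 (one_mem_symbols A), fun y => by simp⟩
    have := hN _ ⟨_, h0, rfl⟩
    have h1 : ℓ (r fun _ => 0) = 0 := by
      rw [hℓ]; simp [r]
    rwa [h1, map_zero] at this
  -- The separation bounds only real parts on the unit ball; rotating and normalizing ψ turns this
  -- into a norm bound.
  have hbound : ∀ T ∈ A, ∀ ψ : X → ℂ, IsMulOp T ψ → ‖∑ i, c i * ψ (x i)‖ ≤ N * ‖T‖ := by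
    intro T hT ψ hψ
    have hψT : ∀ y, ‖ψ y‖ ≤ ‖T‖ := fun y => hψ.norm_apply_le_opNorm (hH y)
    set S := ∑ i, c i * ψ (x i) with hS
    by_cases hS0 : S = 0
    · rw [hS0, norm_zero]; positivity
    have hT0 : 0 < ‖T‖ := by
      refine (norm_nonneg T).lt_of_ne fun h0 => hS0 ?_
      refine Finset.sum_eq_zero fun i _ => ?_
      have := hψT (x i)
      rw [← h0] at this
      rw [norm_le_zero_iff.1 this, mul_zero]
    have hSn : 0 < ‖S‖ := norm_pos_iff.2 hS0
    let θ : ℂ := conj S / (‖S‖ * ‖T‖ : ℝ)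
    have hθ : ‖θ‖ = ‖T‖⁻¹ := by
      simp only [θ]
      rw [norm_div, RCLike.norm_conj, Complex.norm_real, Real.norm_of_nonneg (by positivity)]
      field_simp
    have h1 := hN _ ⟨fun y => θ * ψ y, ⟨smul_mem_symbols θ ⟨T, hT, hψ⟩, fun y => by
      rw [norm_mul, hθ, inv_mul_le_one₀ hT0]; exact hψT y⟩, rfl⟩
    have h2 : ℓ (r fun y => θ * ψ y) = ((‖S‖ / ‖T‖ : ℝ) : ℂ) := by
      rw [hℓ]
      have : ∑ i, c i * r (fun y => θ * ψ y) i = θ * S := by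
        rw [hS, Finset.mul_sum]
        exact Finset.sum_congr rfl fun i _ => by simp only [r]; ring
      rw [this]
      simp only [θ]
      rw [div_mul_eq_mul_div, mul_comm, Complex.mul_conj, Complex.normSq_eq_norm_sq,
        ← Complex.ofReal_div]
      congr 1
      field_simp
    rw [h2] at h1
    have h3 : ‖S‖ / ‖T‖ < N := by simpa using h1
    exact ((div_lt_iff₀ hT0).1 h3).le
  have hle : ∀ ε : ℝ, 0 < ε → ε < 1 → (1 - ε) * ‖∑ i, c i * w i‖ ≤ N + ε := fun ε h0 h1 => by
    obtain ⟨f, g, hf, hnorm, hfg⟩ := exists_vectorFunctional_eq_sum hL2 hH hA hx c hN0.le hbound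
      h0 h1
    refine le_trans ?_ hnorm
    exact mul_le_mul_of_nonneg_left (norm_sum_mul_le_of_posSemidef hL2 hH hA x w c f g hf hfg
      (hpos f)) (by linarith)
  have hlim : (1 - 0) * ‖∑ i, c i * w i‖ ≤ N + 0 := by
    have h1 : Filter.Tendsto (fun ε : ℝ => (1 - ε) * ‖∑ i, c i * w i‖) (𝓝[>] 0)
        (𝓝 ((1 - 0) * ‖∑ i, c i * w i‖)) :=
      Filter.Tendsto.mono_left (Continuous.tendsto (by fun_prop) 0) nhdsWithin_le_nhds
    have h2 : Filter.Tendsto (fun ε : ℝ => N + ε) (𝓝[>] 0) (𝓝 (N + 0)) :=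
      Filter.Tendsto.mono_left (Continuous.tendsto (by fun_prop) 0) nhdsWithin_le_nhds
    refine le_of_tendsto_of_tendsto h1 h2 ?_
    filter_upwards [Ioo_mem_nhdsGT (show (0 : ℝ) < 1 from one_pos)] with ε hε
    exact hle ε hε.1 hε.2
  rw [sub_zero, one_mul, add_zero] at hlim
  have h3 : RCLike.re (ℓ w) ≤ ‖∑ i, c i * w i‖ := by
    rw [hℓ]; exact RCLike.re_le_norm _
  linarith

/-- Interpolants on the components can be glued together. -/
lemma exists_mem_symbolBall_of_posSemidef [SigmaFinite μ] (hL2 : IsSubspaceL2 H μ)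
    (hH : ∀ x : X, ∃ f : H, f x ≠ 0) (hA : IsDualAlgebraOfMultipliers A) {ι : Type*} [Fintype ι]
    (x : ι → X) (w : ι → ℂ)
    (hpos : ∀ f : H, (Matrix.of fun i j => (1 - w i * conj (w j)) *
      kernelFn (symbols A) (absSqMeasure f μ) (x i) (x j)).PosSemidef) :
    ∃ φ ∈ symbolBall A, ∀ i, φ (x i) = w i := by
  classical
  have hcomp : ∀ i₀, ∃ φ ∈ symbolBall A, ∀ i, x i ∈ component A (x i₀) → φ (x i) = w i := by
    intro i₀
    obtain ⟨φ, hφ, h⟩ := exists_mem_symbolBall_of_mem_component hL2 hH hA (x₀ := x i₀)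
      (x := fun i : {i // x i ∈ component A (x i₀)} => x i) (fun i => i.2) (fun i => w i)
      fun f => (hpos f).submatrix (Subtype.val : {i // x i ∈ component A (x i₀)} → ι)
    exact ⟨φ, hφ, fun i hi => h ⟨i, hi⟩⟩
  have hfin : ∀ s : Finset ι, ∃ φ ∈ symbolBall A, ∀ i ∈ s, φ (x i) = w i := by
    intro s
    induction s using Finset.induction_on with
    | empty =>
      exact ⟨fun _ => 1, ⟨one_mem_symbols A, fun y => by simp⟩, by simp⟩
    | insert i₀ s _ ih =>
      obtain ⟨φ, hφ, hs⟩ := ih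
      obtain ⟨ψ, hψ, hi⟩ := hcomp i₀
      have hE := isClopenFor_component hL2 hH hA (x i₀)
      have hin : ∀ y ∈ component A (x i₀), φ y + (component A (x i₀)).indicator (fun _ => (1 : ℂ)) y
          * (ψ y - φ y) = ψ y := fun y hy => by
        rw [Set.indicator_of_mem hy]; ring
      have hout : ∀ y ∉ component A (x i₀), φ y +
          (component A (x i₀)).indicator (fun _ => (1 : ℂ)) y * (ψ y - φ y) = φ y := fun y hy => by
        rw [Set.indicator_of_notMem hy]; ring
      -- The glued function φ + 1_E(ψ - φ) is ψ on the component and φ off it. Earlier points in the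
      -- component cause no conflict, as ψ interpolates at every given point there.
      refine ⟨_, ⟨add_mem_symbols hφ.1 (mul_mem_symbols hE (sub_mem_symbols hψ.1 hφ.1)),
        fun y => ?_⟩, fun i his => ?_⟩
      · by_cases hy : y ∈ component A (x i₀)
        · rw [hin y hy]; exact hψ.2 y
        · rw [hout y hy]; exact hφ.2 y
      · by_cases hy : x i ∈ component A (x i₀)
        · exact (hin _ hy).trans (hi i hy)
        · simp only [hout _ hy]
          rcases Finset.mem_insert.1 his with rfl | his
          · exact absurd (mem_component_self A _) hy
          · exact hs i his
  obtain ⟨φ, hφ, h⟩ := hfin Finset.univ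
  exact ⟨φ, hφ, fun i => h i (Finset.mem_univ i)⟩

end Interpolation

end PickDual

end

theorem corollaryC {X H : Type*} [MeasurableSpace X] (μ : MeasureTheory.Measure X)
    [MeasureTheory.SigmaFinite μ]
    [NormedAddCommGroup H] [InnerProductSpace ℂ H] [CompleteSpace H] [RKHS ℂ H X ℂ]
    (hL2 : PickDual.IsSubspaceL2 H μ)
    (hH : ∀ x : X, ∃ f : H, f x ≠ 0)
    (A : Subalgebra ℂ (H →L[ℂ] H)) (hA : PickDual.IsDualAlgebraOfMultipliers A)
    {n : ℕ} (x : Fin n → X) (w : Fin n → ℂ) :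
    (∃ φ ∈ PickDual.symbols A, (∀ y : X, ‖φ y‖ ≤ 1) ∧ ∀ i, φ (x i) = w i) ↔
      ∀ f : H, (Matrix.of fun i j : Fin n =>
        (1 - w i * conj (w j)) *
          PickDual.kernelFn (PickDual.symbols A) (PickDual.absSqMeasure f μ) (x i) (x j)).PosSemidef := by
  constructor
  · rintro ⟨φ, hφ, hφ1, hφw⟩ f
    obtain rfl : (fun i => φ (x i)) = w := funext hφw
    exact PickDual.posSemidef_of_mem_symbolBall hL2 hH hA x ⟨hφ, hφ1⟩ f
  · intro h
    obtain ⟨φ, hφ, hφw⟩ := PickDual.exists_mem_symbolBall_of_posSemidef hL2 hH hA x w h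
    exact ⟨φ, hφ.1, hφ.2, hφw⟩
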